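/- Let $\beta,\varsigma,\sigma>0$. Let $Q^{(\beta)}=(Q^{(\beta)}_t)_{t\ge0}$ be the Markov semigroup on $[0,\infty)$ generated by $G_\beta=x\partial^2+\beta\partial$ (the transition semigroup of the squared Bessel process $dX_t=\sqrt{2X_t}\,dB_t+\beta\,dt$), i.e. the Markov semigroup such that $\partial_tQ^{(\beta)}_tf(x)=Q^{(\beta)}_tG_\beta f(x)$ for all $x,t\ge0$ and all $f(x)=p(x)e^{-x}$ with $p$ a polynomial. Let $\mathbb Q^{(\beta)}=(\mathbb Q^{(\beta)}_t)_{t\ge0}$ be the Markov semigroup on $\mathbb Z_+$ generated by $\mathbb G_\beta g(n)=(n+\beta)(g(n+1)-g(n))+n(g(n-1)-g(n))$ (a linear birth-death chain), i.e. the Markov semigroup such that $\partial_t\mathbb Q^{(\beta)}_tg(n)=\mathbb Q^{(\beta)}_t\mathbb G_\beta g(n)$ for all $n\in\mathbb Z_+$, $t\ge0$ and all finitely supported $g$. For $c>0$ put $d_cf(x)=f(cx)$, and for $c\in(0,1]$ put $\mathbb D_cg(n)=\sum_{m=0}^n\binom nm c^m(1-c)^{n-m}g(m)$. The Laguerre semigroups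 are, for $t\ge 0$ and $\theta>0$, $$K_t^{(\beta,\varsigma)}=Q^{(\beta)}_{\varsigma(e^t-1)}\,d_{e^{-t}},\qquad \mathbb K_t^{(\beta,\theta)}=\mathbb Q^{(\beta)}_{\theta(e^t-1)}\,\mathbb D_{e^{-t}} .$$ Let $\nu_{\beta,\varsigma}(dx)=\frac{x^{\beta-1}e^{-x/\varsigma}}{\varsigma^\beta\Gamma(\beta)}\,dx$ on $(0,\infty)$ and $\mathbf n_{\beta,\theta}(n)=(1+\theta)^{-\beta}\bigl(\tfrac{\theta}{1+\theta}\bigr)^n\frac{\beta(\beta+1)\cdots(\beta+n-1)}{n!}$, $n\in\mathbb Z_+$, and let $\Lambda_\sigma g(x)=\sum_{n\ge0}g(n)\frac{(\sigma x)^n}{n!}e^{-\sigma x}$. The semigroups $Q^{(\beta)}$ and $\mathbb Q^{(\beta)}$ exist, and the Markov kernels $\Lambda_\sigma$, $K_t^{(\beta,\varsigma)}$ and $\mathbb K_t^{(\beta,\varsigma\sigma)}$ act as bounded operators $\ell^2(\mathbf n_{\beta,\varsigma\sigma})\to L^2(\nu_{\beta,\varsigma})$, $L^2(\nu_{\beta,\varsigma})\to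 L^2(\nu_{\beta,\varsigma})$ and $\ell^2(\mathbf n_{\beta,\varsigma\sigma})\to\ell^2(\mathbf n_{\beta,\varsigma\sigma})$ respectively, for every $t\ge0$. Let $\widehat\Lambda_{\beta,\varsigma,\sigma}:L^2(\nu_{\beta,\varsigma})\to\ell^2(\mathbf n_{\beta,\varsigma\sigma})$ be the adjoint of the operator $\Lambda_\sigma$. Then, for every $t\ge0$, on $L^2(\nu_{\beta,\varsigma})$, $$\mathbb K_t^{(\beta,\varsigma\sigma)}\,\widehat\Lambda_{\beta,\varsigma,\sigma}=\widehat\Lambda_{\beta,\varsigma,\sigma}\,K_t^{(\beta,\varsigma)},$$ and, with the same time $s=\ln\bigl(1+\tfrac1{\varsigma\sigma}\bigr)$ in both identities, $$\Lambda_\sigma\,\widehat\Lambda_{\beta,\varsigma,\sigma}=K_s^{(\beta,\varsigma)}\ \text{ on } L^2(\nu_{\beta,\varsigma}),\qquad \widehat\Lambda_{\beta,\varsigma,\sigma}\,\Lambda_\sigma=\mathbb K_s^{(\beta,\varsigma\sigma)}\ \text{ on } \ell^2(\mathbf n_{\beta,\varsigma\sigma}).$$ -/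

import Mathlib

open MeasureTheory ProbabilityTheory
open scoped NNReal ENNReal

namespace Gateway

noncomputable section

/-! ### Markov semigroups and their generators -/

/-- A (homogeneous) Markov semigroup of transition kernels on `E`. -/
structure IsMarkovSemigroup {E : Type} [MeasurableSpace E] (P : ℝ≥0 → Kernel E E) : Prop where
  isMarkovKernel : ∀ t, IsMarkovKernel (P t)
  zero : P 0 = Kernel.id
  add : ∀ s t, P (s + t) = P t ∘ₖ P s

/-- The Markov semigroup `P` has the operator with graph `𝓖` as generator: for each pair
`(f, G f)` of the graph, each starting point `x` and each time `t ≥ 0`, Kolmogorov's equation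
`∂ₜ Pₜ f (x) = Pₜ (G f) (x)` holds (with the right derivative at time `0`).
For the two graphs used below, on cores of `G`, exactly one Markov semigroup has this property. -/
structure IsGeneratedBy {E : Type} [MeasurableSpace E] (P : ℝ≥0 → Kernel E E)
    (𝓖 : Set ((E → ℝ) × (E → ℝ))) : Prop where
  isMarkovSemigroup : IsMarkovSemigroup P
  kolmogorov : ∀ fg ∈ 𝓖, ∀ x : E, ∀ t : ℝ, 0 ≤ t →
    HasDerivWithinAt (fun s : ℝ => ∫ y, fg.1 y ∂(P s.toNNReal x))
      (∫ y, fg.2 y ∂(P t.toNNReal x)) (Set.Ici 0) t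

/-! ### The squared Bessel semigroup and the linear birth-death semigroup -/

/-- The differential operator `G_β = x ∂² + β ∂`. -/
def besselOp (β : ℝ) (F : ℝ → ℝ) (x : ℝ) : ℝ := x * deriv (deriv F) x + β * deriv F x

/-- The graph of `G_β` on the core of functions `x ↦ p(x) e^{-x}` on `[0, ∞)`, `p` polynomial. -/
def besselGraph (β : ℝ) : Set ((ℝ≥0 → ℝ) × (ℝ≥0 → ℝ)) :=
  {fg | ∃ p : Polynomial ℝ,
    fg.1 = (fun x : ℝ≥0 => p.eval (x : ℝ) * Real.exp (-(x : ℝ))) ∧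
    fg.2 = (fun x : ℝ≥0 => besselOp β (fun y => p.eval y * Real.exp (-y)) x)}

/-- The Markov semigroup `Q^{(β)}` on `[0, ∞)` generated by `G_β`, that is, the transition
semigroup of the squared Bessel process `dX = √(2X) dB + β dt`. -/
def besselSemigroup (β : ℝ) : ℝ≥0 → Kernel ℝ≥0 ℝ≥0 :=
  Classical.epsilon fun P => IsGeneratedBy P (besselGraph β)

/-- The difference operator `𝔾_β = (n + β) ∂₊ + n ∂₋`, with `∂± g (n) = g (n ± 1) - g (n)`
(at `n = 0` the second term is multiplied by `0`). -/
def birthDeathOp (β : ℝ) (g : ℕ → ℝ) (n : ℕ) : ℝ :=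
  ((n : ℝ) + β) * (g (n + 1) - g n) + (n : ℝ) * (g (n - 1) - g n)

/-- The graph of `𝔾_β` on the core of finitely supported functions on `ℕ`. -/
def birthDeathGraph (β : ℝ) : Set ((ℕ → ℝ) × (ℕ → ℝ)) :=
  {fg | fg.1.support.Finite ∧ fg.2 = birthDeathOp β fg.1}

/-- The Markov semigroup `ℚ^{(β)}` on `ℕ` generated by `𝔾_β`, that is, the transition semigroup
of the linear birth-death chain with birth rates `n + β` and death rates `n`. -/
def birthDeathSemigroup (β : ℝ) : ℝ≥0 → Kernel ℕ ℕ :=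
  Classical.epsilon fun P => IsGeneratedBy P (birthDeathGraph β)

/-! ### Dilation, binomial thinning and Poisson kernels -/

/-- The dilation kernel `d_c (x, ·) = δ_{c x}` on `[0, ∞)`, for `c ≥ 0`. -/
def dilation (c : ℝ) : Kernel ℝ≥0 ℝ≥0 :=
  Kernel.deterministic (fun x => c.toNNReal * x) (measurable_const_mul _)

/-- The binomial kernel `𝔻_c (n, m) = C(n, m) c^m (1 - c)^{n - m}` on `ℕ`, for `0 ≤ c ≤ 1`. -/
def thinning (c : ℝ) : Kernel ℕ ℕ :=
  Kernel.ofFunOfCountable fun n => ∑ m ∈ Finset.range (n + 1),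
    ENNReal.ofReal ((n.choose m : ℝ) * c ^ m * (1 - c) ^ (n - m)) • Measure.dirac m

theorem measurable_poissonMeasure : Measurable poissonMeasure := by
  refine Measure.measurable_of_measurable_coe _ fun s hs => ?_
  simp only [poissonMeasure, Measure.sum_apply _ hs, Measure.smul_apply, smul_eq_mul]
  refine Measurable.tsum fun n => Measurable.mul_const ?_ _
  fun_prop

/-- The Markov kernel `Λ` from `[0, ∞)` to `ℕ`: `Λ (x, ·)` is the Poisson law of parameter `x`. -/
def poissonKernel : Kernel ℝ≥0 ℕ := ⟨poissonMeasure, measurable_poissonMeasure⟩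

/-- The Markov kernel `Λ_σ = d_σ Λ`: `Λ_σ (x, ·)` is the Poisson law of parameter `σ x`.
(`κ` followed by `η` is `η ∘ₖ κ`, whose action on functions is `f ↦ κ (η f)`.) -/
def scaledPoissonKernel (σ : ℝ) : Kernel ℝ≥0 ℕ := poissonKernel ∘ₖ dilation σ

/-! ### The Laguerre semigroups and their invariant probability measures -/

/-- `K_t^{(β,ς)} = Q^{(β)}_{ς (e^t - 1)} d_{e^{-t}}`. -/
def laguerreKernel (β ς t : ℝ) : Kernel ℝ≥0 ℝ≥0 :=
  dilation (Real.exp (-t)) ∘ₖ besselSemigroup β (ς * (Real.exp t - 1)).toNNReal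

/-- `𝕂_t^{(β,σ)} = ℚ^{(β)}_{σ (e^t - 1)} 𝔻_{e^{-t}}`. -/
def discreteLaguerreKernel (β σ t : ℝ) : Kernel ℕ ℕ :=
  thinning (Real.exp (-t)) ∘ₖ birthDeathSemigroup β (σ * (Real.exp t - 1)).toNNReal

/-- The gamma law `ν_{β,ς}` of shape `β` and scale `ς` (rate `1/ς`), on `[0, ∞)`. -/
def gammaLaw (β ς : ℝ) : Measure ℝ≥0 := (gammaMeasure β ς⁻¹).map Real.toNNReal

/-- The negative binomial law `𝐧_{β,σ}` on `ℕ`: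
`𝐧_{β,σ}(n) = (1 + σ)^{-β} (σ / (1 + σ))^n β (β + 1) ⋯ (β + n - 1) / n!`. -/
def negBinomialLaw (β σ : ℝ) : Measure ℕ :=
  Measure.sum fun n : ℕ => ENNReal.ofReal ((1 + σ) ^ (-β) * (σ / (1 + σ)) ^ n *
    ((∏ k ∈ Finset.range n, (β + (k : ℝ))) / (n.factorial : ℝ))) • Measure.dirac n

/-! ### Kernels as operators between `L²` spaces -/

/-- `T` is the bounded operator `f ↦ κ f = ∫ f(y) κ(·, dy)` from `L²(π)` to `L²(ρ)`. -/
def IsL2Action {X Y : Type} [MeasurableSpace X] [MeasurableSpace Y] (κ : Kernel X Y)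
    (ρ : Measure X) (π : Measure Y) (T : Lp ℝ 2 π →L[ℝ] Lp ℝ 2 ρ) : Prop :=
  ∀ (f : Y → ℝ) (hf : MemLp f 2 π), (∀ᵐ x ∂ρ, Integrable f (κ x)) ∧
    T (hf.toLp f) =ᵐ[ρ] fun x => ∫ y, f y ∂(κ x)

/-- The kernel `κ` seen as a bounded operator from `L²(π)` to `L²(ρ)`. -/
def l2Op {X Y : Type} [MeasurableSpace X] [MeasurableSpace Y] (κ : Kernel X Y)
    (ρ : Measure X) (π : Measure Y) : Lp ℝ 2 π →L[ℝ] Lp ℝ 2 ρ :=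
  Classical.epsilon (IsL2Action κ ρ π)

/-- `Λ_σ : ℓ²(𝐧_{β,ςσ}) → L²(ν_{β,ς})`. -/
def poissonOp (β ς σ : ℝ) :
    Lp ℝ 2 (negBinomialLaw β (ς * σ)) →L[ℝ] Lp ℝ 2 (gammaLaw β ς) :=
  l2Op (scaledPoissonKernel σ) (gammaLaw β ς) (negBinomialLaw β (ς * σ))

/-- `Λ̂_{β,ς,σ} : L²(ν_{β,ς}) → ℓ²(𝐧_{β,ςσ})`, the adjoint of `Λ_σ`. -/
def poissonAdjoint (β ς σ : ℝ) :
    Lp ℝ 2 (gammaLaw β ς) →L[ℝ] Lp ℝ 2 (negBinomialLaw β (ς * σ)) :=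
  ContinuousLinearMap.adjoint (poissonOp β ς σ)

/-- `K_t^{(β,ς)}` on `L²(ν_{β,ς})`. -/
def laguerreOp (β ς t : ℝ) : Lp ℝ 2 (gammaLaw β ς) →L[ℝ] Lp ℝ 2 (gammaLaw β ς) :=
  l2Op (laguerreKernel β ς t) (gammaLaw β ς) (gammaLaw β ς)

/-- `𝕂_t^{(β,σ)}` on `ℓ²(𝐧_{β,σ})`. -/
def discreteLaguerreOp (β σ t : ℝ) :
    Lp ℝ 2 (negBinomialLaw β σ) →L[ℝ] Lp ℝ 2 (negBinomialLaw β σ) :=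
  l2Op (discreteLaguerreKernel β σ t) (negBinomialLaw β σ) (negBinomialLaw β σ)

end

end Gateway

/-! Everything is computed on two one-parameter families: the exponentials `x ↦ e^{-lx}` on the
half-line and the geometric functions `n ↦ (1-l)^n` on the integers, with `l` in `[0,1]`. Each
family determines finite measures and is therefore total in every `L²` space of a finite measure,
and every operator involved maps a member to a scalar multiple of a member, moving `l` by a Möbius
map. Both semigroups at time `t` give the factor `(1+tl)^{-β}` and the new parameter `l/(1+tl)`.
`Λ_σ` maps the geometric function of parameter `l` to the exponential of rate `lσ`, and its adjoint
is found by testing against geometric functions (`poissonAdjoint_expFun`), without identifying its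
kernel. The three operator identities then reduce to rational identities between factors and
parameters.

The substance lies in the action of the two semigroups, which are given only by their generators.
Kolmogorov's equation on point masses is the forward equation of the birth-death chain. On the
Poisson weights `x^n e^{-x}/n!` the Bessel generator produces the very same equation
(`besselOp_poissonWeight`), so replacing a Bessel law by its Poisson mixture reduces the continuous
case to the discrete one. For generating functions the forward equation is a first-order transport
equation. Integrating it along characteristics shows that every semigroup with the given generator
has the stated transform (`tsum_mul_pow_of_forward`). Conversely, the explicit solution is analytic
and its Taylor coefficients solve the forward equation (`hasDerivWithinAt_of_hasSum_bdPgf`); applied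
to explicit mixture kernels, this proves existence.

Boundedness on `L²` comes from Jensen's inequality: a Markov kernel is a contraction from `L²(ρκ)`
to `L²(ρ)`. The gamma laws are invariant, the negative binomial laws are invariant, and `Λ_σ`
carries the former to the latter. -/

namespace Gateway

noncomputable section

/-! ### Measures determined by exponential and geometric functions -/

/-- The exponential function `x ↦ e^{-l x}` on `[0, ∞)`. -/
def expFun (l : ℝ) (x : ℝ≥0) : ℝ := Real.exp (-(l * x))

/-- The geometric function `n ↦ (1 - l)^n` on `ℕ`. -/
def geomFun (l : ℝ) (n : ℕ) : ℝ := (1 - l) ^ n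

theorem expFun_pos (l : ℝ) (x : ℝ≥0) : 0 < expFun l x := Real.exp_pos _

theorem expFun_le_one {l : ℝ} (hl : 0 ≤ l) (x : ℝ≥0) : expFun l x ≤ 1 :=
  Real.exp_le_one_iff.2 (neg_nonpos.2 (mul_nonneg hl x.2))

@[fun_prop]
theorem measurable_expFun (l : ℝ) : Measurable (expFun l) := by
  unfold expFun; fun_prop

theorem geomFun_nonneg {l : ℝ} (hl : l ≤ 1) (n : ℕ) : 0 ≤ geomFun l n :=
  pow_nonneg (by linarith) n

theorem geomFun_le_one {l : ℝ} (hl : l ≤ 1) (hl0 : 0 ≤ l) (n : ℕ) : geomFun l n ≤ 1 :=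
  pow_le_one₀ (by linarith) (by linarith)

@[fun_prop]
theorem measurable_geomFun (l : ℝ) : Measurable (geomFun l) := measurable_of_countable _

theorem integrable_expFun {μ : Measure ℝ≥0} [IsFiniteMeasure μ] {l : ℝ} (hl : 0 ≤ l) :
    Integrable (expFun l) μ :=
  Integrable.of_bound (measurable_expFun l).aestronglyMeasurable 1
    (ae_of_all _ fun x => by
      rw [Real.norm_of_nonneg (expFun_pos l x).le]; exact expFun_le_one hl x)

theorem integral_expFun (μ : Measure ℝ≥0) (l : ℝ) :
    ∫ x, expFun l x ∂μ = (∫⁻ x, ENNReal.ofReal (expFun l x) ∂μ).toReal :=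
  integral_eq_lintegral_of_nonneg_ae (ae_of_all _ fun x => (expFun_pos l x).le)
    (measurable_expFun l).aestronglyMeasurable

theorem integral_geomFun (μ : Measure ℕ) {l : ℝ} (hl : l ≤ 1) :
    ∫ x, geomFun l x ∂μ = (∫⁻ x, ENNReal.ofReal (geomFun l x) ∂μ).toReal :=
  integral_eq_lintegral_of_nonneg_ae (ae_of_all _ fun x => (geomFun_nonneg hl x))
    (measurable_geomFun l).aestronglyMeasurable

theorem Iio_subset_interior_integrableExpSet (μ : Measure ℝ≥0) [IsFiniteMeasure μ] :
    Set.Iio 0 ⊆ interior (integrableExpSet (fun x : ℝ≥0 => (x : ℝ)) μ) := by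
  refine interior_maximal (fun t ht => ?_) isOpen_Iio
  have := integrable_expFun (μ := μ) (l := -t) (by linarith [Set.mem_Iio.1 ht])
  rwa [show expFun (-t) = fun x : ℝ≥0 => Real.exp (t * (x : ℝ)) by
    funext x; simp [expFun]] at this

/-- The complex moment generating function of a finite measure on the half-line is analytic on the
open left half-plane, so agreement on a real interval spreads by the identity theorem. The base
point `-1/2` could be any point of `(-1,0)`. -/
theorem eqOn_complexMGF_of_lintegral_expFun {μ μ' : Measure ℝ≥0}
    [IsFiniteMeasure μ] [IsFiniteMeasure μ']
    (h : ∀ l ∈ Set.Ioc (0 : ℝ) 1, ∫⁻ x, ENNReal.ofReal (expFun l x) ∂μ =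
      ∫⁻ x, ENNReal.ofReal (expFun l x) ∂μ') :
    Set.EqOn (complexMGF (fun x : ℝ≥0 => (x : ℝ)) μ) (complexMGF (fun x : ℝ≥0 => (x : ℝ)) μ')
      {z | z.re ∈ Set.Iio (0 : ℝ)} := by
  have hA (ρ : Measure ℝ≥0) [IsFiniteMeasure ρ] : AnalyticOnNhd ℂ
      (complexMGF (fun x : ℝ≥0 => (x : ℝ)) ρ) {z | z.re ∈ Set.Iio (0 : ℝ)} :=
    analyticOnNhd_complexMGF.mono fun z hz => Iio_subset_interior_integrableExpSet ρ hz
  refine AnalyticOnNhd.eqOn_of_preconnected_of_frequently_eq (hA μ) (hA μ')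
    ((convex_Iio (0 : ℝ)).linear_preimage Complex.reLm).isPreconnected
    (z₀ := ((-1 / 2 : ℝ) : ℂ)) (by norm_num [Complex.ofReal_re]) ?_
  have h_real : ∃ᶠ t : ℝ in nhdsWithin (-1 / 2) {-1 / 2}ᶜ,
      complexMGF (fun x : ℝ≥0 => (x : ℝ)) μ t = complexMGF (fun x : ℝ≥0 => (x : ℝ)) μ' t := by
    refine Filter.Eventually.frequently ?_
    filter_upwards [nhdsWithin_le_nhds (Ioo_mem_nhds (a := (-1 : ℝ)) (b := 0)
      (by norm_num) (by norm_num))] with t ht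
    rw [complexMGF_ofReal, complexMGF_ofReal]
    have hm (ρ : Measure ℝ≥0) : mgf (fun x : ℝ≥0 => (x : ℝ)) ρ t = ∫ x, expFun (-t) x ∂ρ := by
      simp [mgf, expFun]
    rw [hm, hm, integral_expFun, integral_expFun,
      h (-t) ⟨by linarith [ht.2], by linarith [ht.1]⟩]
  rw [Filter.frequently_iff_seq_forall] at h_real ⊢
  obtain ⟨xs, hx_tendsto, hx_eq⟩ := h_real
  refine ⟨fun n => xs n, ?_, hx_eq⟩
  rw [tendsto_nhdsWithin_iff] at hx_tendsto ⊢
  refine ⟨(Complex.continuous_ofReal.tendsto _).comp hx_tendsto.1, ?_⟩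
  filter_upwards [hx_tendsto.2] with n hn
  simpa only [Set.mem_compl_iff, Set.mem_singleton_iff, Complex.ofReal_inj] using hn

/-- The imaginary axis lies on the boundary of the half-plane of analyticity, so characteristic
functions are not compared directly. Tilting by the density `e^{-x}` moves them to the line of real
part `-1`; the tilt is then undone because its density is positive and finite. -/
theorem measure_ext_of_lintegral_expFun {μ μ' : Measure ℝ≥0}
    [IsFiniteMeasure μ] [IsFiniteMeasure μ']
    (h : ∀ l ∈ Set.Ioc (0 : ℝ) 1, ∫⁻ x, ENNReal.ofReal (expFun l x) ∂μ =
      ∫⁻ x, ENNReal.ofReal (expFun l x) ∂μ') : μ = μ' := by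
  have hEq := eqOn_complexMGF_of_lintegral_expFun h
  have hmeas : Measurable fun x : ℝ≥0 => ENNReal.ofReal (expFun 1 x) := by fun_prop
  have hfin (ρ : Measure ℝ≥0) [IsFiniteMeasure ρ] :
      IsFiniteMeasure (ρ.withDensity fun x => ENNReal.ofReal (expFun 1 x)) :=
    isFiniteMeasure_withDensity_ofReal (integrable_expFun zero_le_one).2
  have hc (ρ : Measure ℝ≥0) [IsFiniteMeasure ρ] (t : ℝ) :
      charFun ((ρ.withDensity fun x => ENNReal.ofReal (expFun 1 x)).map
        (fun x : ℝ≥0 => (x : ℝ))) t =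
      complexMGF (fun x : ℝ≥0 => (x : ℝ)) ρ (-1 + t * Complex.I) := by
    rw [← complexMGF_mul_I (by fun_prop), complexMGF, complexMGF,
      integral_withDensity_eq_integral_toReal_smul hmeas (by simp)]
    refine integral_congr_ae (ae_of_all _ fun x => ?_)
    beta_reduce
    rw [ENNReal.toReal_ofReal (expFun_pos 1 x).le, expFun, Complex.real_smul,
      Complex.ofReal_exp, ← Complex.exp_add]
    congr 1
    push_cast
    ring
  have hmap : (μ.withDensity fun x => ENNReal.ofReal (expFun 1 x)).map (fun x : ℝ≥0 => (x : ℝ)) =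
      (μ'.withDensity fun x => ENNReal.ofReal (expFun 1 x)).map (fun x : ℝ≥0 => (x : ℝ)) := by
    have := hfin μ
    have := hfin μ'
    refine Measure.ext_of_charFun (funext fun t => ?_)
    rw [hc, hc]
    exact hEq (by simp)
  have hemb : MeasurableEmbedding (fun x : ℝ≥0 => (x : ℝ)) :=
    MeasurableEmbedding.subtype_coe measurableSet_Ici
  have hwd : (μ.withDensity fun x => ENNReal.ofReal (expFun 1 x)) =
      (μ'.withDensity fun x => ENNReal.ofReal (expFun 1 x)) := by
    rw [← hemb.comap_map (μ.withDensity _), hmap, hemb.comap_map]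
  have hinv (ρ : Measure ℝ≥0) := withDensity_inv_same (μ := ρ) hmeas
    (ae_of_all _ fun x => by simpa using expFun_pos 1 x) (ae_of_all _ fun x => by simp)
  rw [← hinv μ, ← hinv μ', hwd]

theorem measure_ext_of_lintegral_geomFun {μ μ' : Measure ℕ}
    [IsFiniteMeasure μ] [IsFiniteMeasure μ']
    (h : ∀ l ∈ Set.Ioc (0 : ℝ) 1, ∫⁻ x, ENNReal.ofReal (geomFun l x) ∂μ =
      ∫⁻ x, ENNReal.ofReal (geomFun l x) ∂μ') : μ = μ' := by
  have hmap : μ.map (fun n : ℕ => (n : ℝ≥0)) = μ'.map (fun n : ℕ => (n : ℝ≥0)) := by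
    refine measure_ext_of_lintegral_expFun fun l hl => ?_
    have hk (ρ : Measure ℕ) : ∫⁻ x, ENNReal.ofReal (expFun l x) ∂(ρ.map fun n : ℕ => (n : ℝ≥0)) =
        ∫⁻ n, ENNReal.ofReal (geomFun (1 - Real.exp (-l)) n) ∂ρ := by
      rw [lintegral_map (by fun_prop) (measurable_of_countable _)]
      refine lintegral_congr fun n => ?_
      rw [expFun, geomFun, sub_sub_cancel, ← Real.exp_nat_mul]
      congr 2
      push_cast
      ring
    rw [hk, hk]
    -- On integers `e^{-ln}` is the geometric function of parameter `1 - e^{-l}`, which lies in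
    -- `(0,1)`.
    refine h _ ⟨?_, by linarith [Real.exp_pos (-l)]⟩
    have := Real.exp_lt_one_iff.2 (neg_lt_zero.2 hl.1)
    linarith
  refine Measure.ext_of_singleton fun n => ?_
  have hn := congrArg (fun ρ => ρ {(n : ℝ≥0)}) hmap
  simp only [Measure.map_apply (measurable_of_countable (fun n : ℕ => (n : ℝ≥0)))
    (measurableSet_singleton _)] at hn
  have hp : (fun n : ℕ => (n : ℝ≥0)) ⁻¹' {(n : ℝ≥0)} = {n} := by ext; simp
  rwa [hp] at hn

/-! ### Transforms of the elementary kernels -/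

/-- The Poisson weight `x ↦ x^n e^{-x} / n!`. -/
def poissonWeight (n : ℕ) (x : ℝ) : ℝ := x ^ n * Real.exp (-x) / n.factorial

theorem poissonKernel_apply (x : ℝ≥0) : poissonKernel x = poissonMeasure x := rfl

theorem poissonMeasure_singleton_eq (x : ℝ≥0) (n : ℕ) :
    poissonMeasure x {n} = ENNReal.ofReal (poissonWeight n x) := by
  rw [poissonMeasure_singleton, poissonWeight]
  congr 1
  ring

instance : IsMarkovKernel poissonKernel :=
  ⟨fun x => by rw [poissonKernel_apply]; infer_instance⟩

theorem lintegral_poissonMeasure_geomFun (x : ℝ≥0) {l : ℝ} (hl : l ≤ 1) :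
    ∫⁻ n, ENNReal.ofReal (geomFun l n) ∂(poissonMeasure x) = ENNReal.ofReal (expFun l x) := by
  rw [lintegral_countable']
  simp only [poissonMeasure_singleton_eq]
  have hs : HasSum (fun n => geomFun l n * poissonWeight n x) (expFun l x) := by
    have h := (NormedSpace.expSeries_div_hasSum_exp ((1 - l) * (x : ℝ))).mul_right
      (Real.exp (-(x : ℝ)))
    rw [← Real.exp_eq_exp_ℝ, ← Real.exp_add] at h
    rw [show (1 - l) * (x : ℝ) + -(x : ℝ) = -(l * x) by ring] at h
    refine h.congr_fun fun n => ?_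
    rw [geomFun, poissonWeight, mul_pow]
    ring
  have h0 : ∀ n, 0 ≤ geomFun l n * poissonWeight n x := fun n =>
    mul_nonneg (geomFun_nonneg hl n) (by unfold poissonWeight; positivity)
  rw [← hs.tsum_eq, ENNReal.ofReal_tsum_of_nonneg h0 hs.summable]
  exact tsum_congr fun n => (ENNReal.ofReal_mul (geomFun_nonneg hl n)).symm

instance (c : ℝ) : IsMarkovKernel (dilation c) := by
  unfold dilation; infer_instance

instance (σ : ℝ) : IsMarkovKernel (scaledPoissonKernel σ) := by
  unfold scaledPoissonKernel; infer_instance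

theorem dilation_apply (c : ℝ) (x : ℝ≥0) : dilation c x = Measure.dirac (c.toNNReal * x) := by
  rw [dilation, Kernel.deterministic_apply]

theorem comp_dilation_apply {E : Type} [MeasurableSpace E] (κ : Kernel ℝ≥0 E) (c : ℝ) (x : ℝ≥0) :
    (κ ∘ₖ dilation c) x = κ (c.toNNReal * x) := by
  rw [Kernel.comp_apply, dilation_apply, Measure.dirac_bind (Kernel.measurable κ)]

theorem scaledPoissonKernel_apply (σ : ℝ) (x : ℝ≥0) :
    scaledPoissonKernel σ x = poissonMeasure (σ.toNNReal * x) := by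
  rw [scaledPoissonKernel, comp_dilation_apply, poissonKernel_apply]

theorem expFun_mul_left {c : ℝ} (hc : 0 ≤ c) (l : ℝ) (x : ℝ≥0) :
    expFun l (c.toNNReal * x) = expFun (l * c) x := by
  simp [expFun, Real.coe_toNNReal c hc, mul_assoc]

theorem lintegral_dilation_expFun {c : ℝ} (hc : 0 ≤ c) (l : ℝ) (x : ℝ≥0) :
    ∫⁻ y, ENNReal.ofReal (expFun l y) ∂(dilation c x) = ENNReal.ofReal (expFun (l * c) x) := by
  rw [dilation_apply, lintegral_dirac' _ (by fun_prop), expFun_mul_left hc]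

theorem lintegral_scaledPoissonKernel_geomFun {σ : ℝ} (hσ : 0 ≤ σ) (x : ℝ≥0) {l : ℝ}
    (hl : l ≤ 1) :
    ∫⁻ n, ENNReal.ofReal (geomFun l n) ∂(scaledPoissonKernel σ x) =
      ENNReal.ofReal (expFun (l * σ) x) := by
  rw [scaledPoissonKernel_apply, lintegral_poissonMeasure_geomFun _ hl, expFun_mul_left hσ]

theorem thinning_apply (c : ℝ) (n : ℕ) : thinning c n = ∑ m ∈ Finset.range (n + 1),
    ENNReal.ofReal ((n.choose m : ℝ) * c ^ m * (1 - c) ^ (n - m)) • Measure.dirac m := rfl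

theorem lintegral_thinning {c : ℝ} (hc : 0 ≤ c) (hc1 : c ≤ 1) (n : ℕ) {g : ℕ → ℝ}
    (hg : ∀ m, 0 ≤ g m) :
    ∫⁻ m, ENNReal.ofReal (g m) ∂(thinning c n) = ENNReal.ofReal (∑ m ∈ Finset.range (n + 1),
      (n.choose m : ℝ) * c ^ m * (1 - c) ^ (n - m) * g m) := by
  have h1 : 0 ≤ 1 - c := by linarith
  rw [thinning_apply, lintegral_finsetSum_measure, ENNReal.ofReal_sum_of_nonneg]
  · refine Finset.sum_congr rfl fun m _ => ?_
    rw [lintegral_smul_measure, lintegral_dirac, smul_eq_mul, ← ENNReal.ofReal_mul (by positivity)]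
  · intro m _
    have := hg m
    positivity

theorem lintegral_thinning_geomFun {c : ℝ} (hc : 0 ≤ c) (hc1 : c ≤ 1) (n : ℕ) {l : ℝ}
    (hl : l ≤ 1) :
    ∫⁻ m, ENNReal.ofReal (geomFun l m) ∂(thinning c n) = ENNReal.ofReal (geomFun (l * c) n) := by
  rw [lintegral_thinning hc hc1 n (geomFun_nonneg hl)]
  congr 1
  rw [geomFun, show 1 - l * c = c * (1 - l) + (1 - c) by ring, add_pow]
  refine Finset.sum_congr rfl fun m _ => ?_
  rw [geomFun, mul_pow]
  ring

/-! ### The gamma and negative binomial laws -/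

theorem isProbabilityMeasure_gammaLaw {β ς : ℝ} (hβ : 0 < β) (hς : 0 < ς) :
    IsProbabilityMeasure (gammaLaw β ς) := by
  have := isProbabilityMeasure_gammaMeasure hβ (inv_pos.2 hς)
  exact Measure.isProbabilityMeasure_map (by fun_prop)

theorem lintegral_gammaLaw {β ς : ℝ} {f : ℝ → ℝ≥0∞} (hf : Measurable f) :
    ∫⁻ x : ℝ≥0, f x ∂(gammaLaw β ς) = ∫⁻ x, gammaPDF β ς⁻¹ x * f x := by
  have hm : Measurable (gammaPDF β ς⁻¹) := (measurable_gammaPDFReal β ς⁻¹).ennreal_ofReal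
  rw [gammaLaw, lintegral_map (f := fun x : ℝ≥0 => f x) (by fun_prop) (by fun_prop), gammaMeasure,
    lintegral_withDensity_eq_lintegral_mul _ hm (by fun_prop)]
  refine lintegral_congr fun x => ?_
  rcases lt_or_ge x 0 with hx | hx
  · simp [gammaPDF_of_neg hx]
  · simp [max_eq_left hx]

/-- Exponential tilting stays inside the gamma family, so the Laplace transform is read off from the
normalisation of the tilted density. -/
theorem gammaPDF_mul_exp {β r : ℝ} (l : ℝ) (hr : 0 < r) (hl : 0 < r + l) (x : ℝ) :
    gammaPDF β r x * ENNReal.ofReal (Real.exp (-(l * x))) =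
      ENNReal.ofReal ((r / (r + l)) ^ β) * gammaPDF β (r + l) x := by
  rcases lt_or_ge x 0 with hx | hx
  · simp [gammaPDF_of_neg hx]
  · rw [gammaPDF_of_nonneg hx, gammaPDF_of_nonneg hx, ← ENNReal.ofReal_mul' (Real.exp_pos _).le,
      ← ENNReal.ofReal_mul (by positivity)]
    congr 1
    have : (r + l) ^ β ≠ 0 := (Real.rpow_pos_of_pos hl β).ne'
    rw [mul_assoc, ← Real.exp_add, Real.div_rpow hr.le hl.le,
      show -(r * x) + -(l * x) = -((r + l) * x) by ring]
    field_simp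

theorem lintegral_gammaLaw_expFun {β ς l : ℝ} (hβ : 0 < β) (hς : 0 < ς) (hl : 0 ≤ l) :
    ∫⁻ x, ENNReal.ofReal (expFun l x) ∂(gammaLaw β ς) = ENNReal.ofReal ((1 + ς * l) ^ (-β)) := by
  have hr : 0 < ς⁻¹ := inv_pos.2 hς
  have hrl : 0 < ς⁻¹ + l := by linarith
  have h := lintegral_gammaLaw (β := β) (ς := ς)
    (f := fun x => ENNReal.ofReal (Real.exp (-(l * x)))) (by fun_prop)
  simp only [gammaPDF_mul_exp l hr hrl] at h
  rw [lintegral_const_mul' _ _ ENNReal.ofReal_ne_top, lintegral_gammaPDF_eq_one hβ hrl,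
    mul_one] at h
  simp only [expFun]
  rw [h]
  have h2 : ς⁻¹ / (ς⁻¹ + l) = (1 + ς * l)⁻¹ := by field_simp
  rw [h2, Real.inv_rpow (by positivity), Real.rpow_neg (by positivity)]

theorem Gamma_add_nat (β : ℝ) (hβ : 0 < β) (n : ℕ) :
    Real.Gamma (β + n) = (∏ k ∈ Finset.range n, (β + (k : ℝ))) * Real.Gamma β := by
  induction n with
  | zero => simp
  | succ n ih =>
    rw [Finset.prod_range_succ, Nat.cast_succ, ← add_assoc,
      Real.Gamma_add_one (by positivity), ih]
    ring

theorem negBinomialLaw_singleton (β θ : ℝ) (n : ℕ) : negBinomialLaw β θ {n} =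
    ENNReal.ofReal ((1 + θ) ^ (-β) * (θ / (1 + θ)) ^ n *
      ((∏ k ∈ Finset.range n, (β + (k : ℝ))) / (n.factorial : ℝ))) := by
  rw [negBinomialLaw, Measure.sum_apply _ (measurableSet_singleton n), tsum_eq_single n]
  · simp
  · intro m hm
    simp [hm]

/-- Gamma-Poisson conjugacy: the weight raises the shape by `n` and the rate by `σ`. The null point
`0` is left out so that real powers may be split. -/
theorem gammaPDF_mul_poissonWeight {β r σ : ℝ} (hβ : 0 < β) (hr : 0 < r) (hσ : 0 < σ) (n : ℕ)
    {x : ℝ} (hx0 : x ≠ 0) :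
    gammaPDF β r x * ENNReal.ofReal (poissonWeight n (σ * x)) =
      ENNReal.ofReal ((r / (r + σ)) ^ β * (σ / (r + σ)) ^ n *
        ((∏ k ∈ Finset.range n, (β + (k : ℝ))) / (n.factorial : ℝ))) *
        gammaPDF (β + n) (r + σ) x := by
  have hP : 0 < ∏ k ∈ Finset.range n, (β + (k : ℝ)) :=
    Finset.prod_pos fun k _ => by positivity
  rcases lt_or_gt_of_ne hx0 with hx | hx
  · simp [gammaPDF_of_neg hx]
  · rw [gammaPDF_of_nonneg hx.le, gammaPDF_of_nonneg hx.le,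
      ← ENNReal.ofReal_mul (by have := Real.Gamma_pos_of_pos hβ; positivity),
      ← ENNReal.ofReal_mul (by positivity)]
    congr 1
    have hG := (Real.Gamma_pos_of_pos hβ).ne'
    have h1 : (r + σ) ^ β ≠ 0 := (Real.rpow_pos_of_pos (by positivity) β).ne'
    rw [Gamma_add_nat β hβ, poissonWeight, show β + n - 1 = (β - 1) + n by ring,
      Real.rpow_add_natCast hx.ne', Real.rpow_add_natCast (by positivity),
      Real.div_rpow hr.le (by positivity),
      show -((r + σ) * x) = -(r * x) + -(σ * x) by ring, Real.exp_add, mul_pow, div_pow]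
    field_simp

/-- This makes `Λ_σ` a contraction between the two `L²` spaces. With `σ = 1` it also transfers total
mass and transforms from gamma to negative binomial laws. -/
theorem gammaLaw_bind_scaledPoissonKernel {β ς σ : ℝ} (hβ : 0 < β) (hς : 0 < ς) (hσ : 0 < σ) :
    (gammaLaw β ς).bind (scaledPoissonKernel σ) = negBinomialLaw β (ς * σ) := by
  refine Measure.ext_of_singleton fun n => ?_
  have hr : 0 < ς⁻¹ := inv_pos.2 hς
  rw [Measure.bind_apply (measurableSet_singleton n) (Kernel.aemeasurable _),
    negBinomialLaw_singleton]
  have h := lintegral_gammaLaw (β := β) (ς := ς)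
    (f := fun x => ENNReal.ofReal (poissonWeight n (σ * x)))
    (by unfold poissonWeight; fun_prop)
  rw [lintegral_congr_ae ((Measure.ae_ne volume (0 : ℝ)).mono fun x hx =>
      gammaPDF_mul_poissonWeight hβ hr hσ n hx), lintegral_const_mul' _ _ ENNReal.ofReal_ne_top,
    lintegral_gammaPDF_eq_one (by positivity) (by positivity), mul_one] at h
  simp only [scaledPoissonKernel_apply, poissonMeasure_singleton_eq]
  simp only [NNReal.coe_mul, Real.coe_toNNReal σ hσ.le]
  rw [h]
  have h3 : ς⁻¹ / (ς⁻¹ + σ) = (1 + ς * σ)⁻¹ := by field_simp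
  have h4 : σ / (ς⁻¹ + σ) = ς * σ / (1 + ς * σ) := by field_simp
  rw [h3, h4, Real.inv_rpow (by positivity), Real.rpow_neg (by positivity)]

theorem isProbabilityMeasure_negBinomialLaw {β θ : ℝ} (hβ : 0 < β) (hθ : 0 < θ) :
    IsProbabilityMeasure (negBinomialLaw β θ) := by
  have := isProbabilityMeasure_gammaLaw hβ hθ
  rw [← mul_one θ, ← gammaLaw_bind_scaledPoissonKernel hβ hθ one_pos]
  infer_instance

theorem lintegral_negBinomialLaw_geomFun {β θ l : ℝ} (hβ : 0 < β) (hθ : 0 < θ) (hl : 0 ≤ l)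
    (hl1 : l ≤ 1) :
    ∫⁻ n, ENNReal.ofReal (geomFun l n) ∂(negBinomialLaw β θ) =
      ENNReal.ofReal ((1 + θ * l) ^ (-β)) := by
  rw [← mul_one θ, ← gammaLaw_bind_scaledPoissonKernel hβ hθ one_pos,
    Measure.lintegral_bind (Kernel.aemeasurable _) (Measurable.aemeasurable (by fun_prop))]
  simp only [lintegral_scaledPoissonKernel_geomFun zero_le_one _ hl1, mul_one]
  exact lintegral_gammaLaw_expFun hβ hθ hl

/-! ### The forward equation of the linear birth-death chain -/

/-- The right-hand side of the forward equation of the birth-death chain. -/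
def forward (β : ℝ) (u : ℕ → ℝ) : ℕ → ℝ
  | 0 => u 1 - β * u 0
  | n + 1 => (n + β) * u n + (n + 2) * u (n + 2) - (2 * (n + 1) + β) * u (n + 1)

theorem summable_succ_mul_pow {z : ℝ} (hz : 0 ≤ z) (hz1 : z < 1) :
    Summable fun n : ℕ => ((n : ℝ) + 1) * z ^ n := by
  have h1 := summable_pow_mul_geometric_of_norm_lt_one 1 (r := z)
    (by rwa [Real.norm_of_nonneg hz])
  have h2 := summable_geometric_of_lt_one hz hz1
  refine (h1.add h2).congr fun n => ?_
  simp only [pow_one]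
  ring

theorem summable_mul_pow {u : ℕ → ℝ} (hu : ∀ n, |u n| ≤ 1) {z : ℝ} (hz : 0 ≤ z) (hz1 : z < 1) :
    Summable fun n : ℕ => u n * z ^ n :=
  Summable.of_norm_bounded (summable_geometric_of_lt_one hz hz1) fun n => by
    rw [norm_mul, norm_pow, Real.norm_of_nonneg hz, Real.norm_eq_abs]
    exact mul_le_of_le_one_left (by positivity) (hu n)

theorem summable_succ_mul_shift_mul_pow {u : ℕ → ℝ} (hu : ∀ n, |u n| ≤ 1) {z : ℝ} (hz : 0 ≤ z)
    (hz1 : z < 1) : Summable fun n : ℕ => ((n : ℝ) + 1) * u (n + 1) * z ^ n :=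
  Summable.of_norm_bounded (summable_succ_mul_pow hz hz1) fun n => by
    rw [norm_mul, norm_mul, norm_pow, Real.norm_of_nonneg hz, Real.norm_eq_abs, Real.norm_eq_abs,
      abs_of_nonneg (by positivity : (0 : ℝ) ≤ n + 1)]
    gcongr
    exact mul_le_of_le_one_right (by positivity) (hu _)

theorem HasSum.of_succ {f : ℕ → ℝ} {a : ℝ} (h0 : f 0 = 0) (h : HasSum (fun n => f (n + 1)) a) :
    HasSum f a := by
  have := (hasSum_nat_add_iff 1).1 h
  simpa [h0] using this

/-- `D` is the `z`-derivative of the generating function `S`, so the forward equation becomes the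
transport equation `∂ₜS = (1-z)² ∂_z S - β(1-z) S`. -/
theorem hasSum_forward_mul_pow {β : ℝ} {u : ℕ → ℝ} {z S D : ℝ}
    (hS : HasSum (fun n => u n * z ^ n) S)
    (hD : HasSum (fun n : ℕ => ((n : ℝ) + 1) * u (n + 1) * z ^ n) D) :
    HasSum (fun n => forward β u n * z ^ n) ((1 - z) ^ 2 * D - β * (1 - z) * S) := by
  have h1 : HasSum (fun n : ℕ => (n : ℝ) * u n * z ^ n) (z * D) := by
    refine HasSum.of_succ (by simp) ((hD.mul_left z).congr_fun fun n => ?_)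
    push_cast
    ring
  have h2 : HasSum (fun n : ℕ => ((n : ℝ) + β) * u n * z ^ n) (z * D + β * S) :=
    (h1.add (hS.mul_left β)).congr_fun fun n => by ring
  have h3 : HasSum (fun n : ℕ => Nat.casesOn n 0 fun m => ((m : ℝ) + β) * u m * z ^ (m + 1))
      (z * (z * D + β * S)) := by
    refine HasSum.of_succ rfl ((h2.mul_left z).congr_fun fun n => ?_)
    simp only
    ring
  rw [show (1 - z) ^ 2 * D - β * (1 - z) * S =
    D - (2 * (z * D) + β * S) + z * (z * D + β * S) by ring]
  refine ((hD.sub ((h1.mul_left 2).add (hS.mul_left β))).add h3).congr_fun fun n => ?_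
  cases n with
  | zero => simp [forward]
  | succ n => simp only [forward]; push_cast; ring

/-- Linear growth of the rates gives a summable majorant against `r^n`, `r < 1`, for termwise
differentiation. -/
theorem abs_forward_le {β : ℝ} (hβ : 0 < β) {u : ℕ → ℝ} (hu : ∀ n, |u n| ≤ 1) (n : ℕ) :
    |forward β u n| ≤ (4 + 2 * β) * (n + 1) := by
  cases n with
  | zero =>
    simp only [forward]
    have h0 := abs_le.1 (hu 0)
    have h1 := abs_le.1 (hu 1)
    rw [abs_le]
    push_cast
    constructor <;> nlinarith
  | succ n =>
    simp only [forward]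
    have h0 := abs_le.1 (hu n)
    have h1 := abs_le.1 (hu (n + 1))
    have h2 := abs_le.1 (hu (n + 2))
    have hn : (0 : ℝ) ≤ n := n.cast_nonneg
    have e0 : |((n : ℝ) + β) * u n| ≤ n + β := by
      rw [abs_mul, abs_of_nonneg (by positivity)]
      exact mul_le_of_le_one_right (by positivity) (hu _)
    have e2 : |((n : ℝ) + 2) * u (n + 2)| ≤ n + 2 := by
      rw [abs_mul, abs_of_nonneg (by positivity)]
      exact mul_le_of_le_one_right (by positivity) (hu _)
    have e1 : |(2 * ((n : ℝ) + 1) + β) * u (n + 1)| ≤ 2 * (n + 1) + β := by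
      rw [abs_mul, abs_of_nonneg (by positivity)]
      exact mul_le_of_le_one_right (by positivity) (hu _)
    refine (abs_sub _ _).trans ((add_le_add ((abs_add_le _ _).trans (add_le_add e0 e2)) e1).trans ?_)
    push_cast
    nlinarith

/-- The generating function of a solution of the forward equation is constant, up to an explicit
factor, along the characteristics `1 - z = 1 / (w - s)`. -/
theorem tsum_mul_pow_of_forward {β : ℝ} (hβ : 0 < β) {u : ℝ → ℕ → ℝ} (hu : ∀ t n, |u t n| ≤ 1)
    (hf : ∀ n t, 0 ≤ t → HasDerivWithinAt (fun s => u s n) (forward β (u t) n) (Set.Ici 0) t)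
    {T : ℝ} (hT : 0 ≤ T) {w : ℝ} (hw : 1 ≤ w) :
    ∑' n, u T n * (1 - 1 / w) ^ n =
      (1 + T / w) ^ (-β) * ∑' n, u 0 n * (1 - 1 / (w + T)) ^ n := by
  rcases hT.eq_or_lt with rfl | hT
  · simp
  -- The characteristic that ends at `1 - 1/w` at time `T`. It decreases from its starting value
  -- `r`, so `r < 1` bounds it uniformly.
  set ζ : ℝ → ℝ := fun s => 1 - 1 / (w + T - s) with hζ
  set r : ℝ := 1 - 1 / (w + T) with hr
  have hwT : 0 < w + T := by linarith
  have hr1 : r < 1 := by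
    have : 0 < 1 / (w + T) := by positivity
    linarith
  have hr0 : 0 ≤ r := by
    have : 1 / (w + T) ≤ 1 := by rw [div_le_one hwT]; linarith
    linarith
  have hζ0 : ∀ s ∈ Set.Icc 0 T, 0 ≤ ζ s := fun s hs => by
    have : 1 / (w + T - s) ≤ 1 := by
      rw [div_le_one (by linarith [hs.2])]; linarith [hs.2]
    simp only [hζ]; linarith
  have hζr : ∀ s ∈ Set.Icc 0 T, ζ s ≤ r := fun s hs => by
    have : 1 / (w + T) ≤ 1 / (w + T - s) :=
      one_div_le_one_div_of_le (by linarith [hs.2]) (by linarith [hs.1])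
    simp only [hζ, hr]; linarith
  have hζd : ∀ s ∈ Set.Icc 0 T, HasDerivAt ζ (-(1 - ζ s) ^ 2) s := fun s hs => by
    have hne : w + T - s ≠ 0 := by linarith [hs.2]
    have h1 : HasDerivAt (fun s => w + T - s) (-1) s := by
      simpa using (hasDerivAt_id s).const_sub (w + T)
    have h2 := (h1.inv hne).const_sub 1
    simp only [hζ, one_div]
    refine h2.congr_deriv ?_
    rw [sub_sub_cancel]
    field_simp
  set F : ℝ → ℝ := fun s => ∑' n, u s n * ζ s ^ n with hF
  have hFc : ContinuousOn F (Set.Icc 0 T) := by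
    refine continuousOn_tsum (u := fun n => r ^ n) (fun n => ?_)
      (summable_geometric_of_lt_one hr0 hr1) fun n s hs => ?_
    · refine ContinuousOn.mul (fun s hs => ?_) (ContinuousOn.pow (fun s hs => ?_) n)
      · exact ((hf n s hs.1).continuousWithinAt).mono Set.Icc_subset_Ici_self
      · exact (hζd s hs).continuousAt.continuousWithinAt
    · rw [norm_mul, norm_pow, Real.norm_of_nonneg (hζ0 s hs), Real.norm_eq_abs]
      exact (mul_le_of_le_one_left (by have := hζ0 s hs; positivity) (hu s n)).trans
        (pow_le_pow_left₀ (hζ0 s hs) (hζr s hs) n)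
  have hFd : ∀ s ∈ Set.Ioo 0 T, HasDerivAt F (-β * (1 - ζ s) * F s) s := by
    intro s hs
    have hsum : Summable fun n : ℕ => (4 + 2 * β) * (((n : ℝ) + 1) * r ^ n) + n * r ^ (n - 1) := by
      refine ((summable_succ_mul_pow hr0 hr1).mul_left _).add ((summable_nat_add_iff 1).1 ?_)
      simpa using summable_succ_mul_pow hr0 hr1
    have hd := hasDerivAt_tsum_of_isPreconnected (g := fun n s => u s n * ζ s ^ n)
      (g' := fun n s => forward β (u s) n * ζ s ^ n +
        u s n * ((n : ℝ) * ζ s ^ (n - 1) * (-(1 - ζ s) ^ 2))) hsum isOpen_Ioo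
      (t := Set.Ioo 0 T) isPreconnected_Ioo (fun n y hy => ?_) (fun n y hy => ?_) hs
      (summable_mul_pow (hu s) (hζ0 s ⟨hs.1.le, hs.2.le⟩)
        ((hζr s ⟨hs.1.le, hs.2.le⟩).trans_lt hr1)) hs
    · have hz0 := hζ0 s ⟨hs.1.le, hs.2.le⟩
      have hz1 := (hζr s ⟨hs.1.le, hs.2.le⟩).trans_lt hr1
      refine hd.congr_deriv ?_
      have hS := (summable_mul_pow (hu s) hz0 hz1).hasSum
      have hD := (summable_succ_mul_shift_mul_pow (hu s) hz0 hz1).hasSum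
      set D := ∑' n : ℕ, ((n : ℝ) + 1) * u s (n + 1) * ζ s ^ n
      have h2 : HasSum (fun n : ℕ => u s n * ((n : ℝ) * ζ s ^ (n - 1) * (-(1 - ζ s) ^ 2)))
          (-(1 - ζ s) ^ 2 * D) := by
        refine HasSum.of_succ (by simp) ((hD.mul_left (-(1 - ζ s) ^ 2)).congr_fun fun n => ?_)
        simp only [Nat.add_sub_cancel]
        push_cast
        ring
      -- The term `(1-ζ)² D` of the forward equation cancels against the one produced by the motion
      -- of `ζ`; only the zeroth-order term survives.
      rw [((hasSum_forward_mul_pow (β := β) hS hD).add h2).tsum_eq]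
      simp only [hF]
      ring
    · have hy' : y ∈ Set.Icc 0 T := ⟨hy.1.le, hy.2.le⟩
      have h1 : HasDerivAt (fun s => u s n) (forward β (u y) n) y :=
        (hf n y hy.1.le).hasDerivAt (Ici_mem_nhds hy.1)
      exact h1.mul ((hζd y hy').pow n)
    · have hy' : y ∈ Set.Icc 0 T := ⟨hy.1.le, hy.2.le⟩
      have hz0 := hζ0 y hy'
      have hzr := hζr y hy'
      have hp := pow_le_pow_left₀ hz0 hzr n
      have hp' := pow_le_pow_left₀ hz0 hzr (n - 1)
      refine (norm_add_le _ _).trans (add_le_add ?_ ?_)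
      · rw [norm_mul, norm_pow, Real.norm_of_nonneg hz0, Real.norm_eq_abs, ← mul_assoc]
        exact mul_le_mul (abs_forward_le hβ (hu y) n) hp (by positivity) (by positivity)
      · have hsq : (1 - ζ y) ^ 2 ≤ 1 := pow_le_one₀ (by linarith) (by linarith)
        rw [norm_mul, norm_mul, norm_mul, norm_neg, norm_pow, norm_pow, Real.norm_of_nonneg hz0,
          Real.norm_eq_abs, Real.norm_natCast, Real.norm_eq_abs, sq_abs]
        calc _ ≤ 1 * (n * r ^ (n - 1) * 1) := by
              gcongr
              exact hu y n
          _ = _ := by ring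
  -- Integrating factor for `F' = -β F / (w+T-s)`. The mean value theorem needs differentiability
  -- only on the open interval, where the one-sided hypothesis gives a two-sided derivative.
  have hGc : ContinuousOn (fun s => F s * (w + T - s) ^ (-β)) (Set.Icc 0 T) :=
    hFc.mul (ContinuousOn.rpow_const (by fun_prop) fun s hs => Or.inl (by linarith [hs.2]))
  have hGd : ∀ s ∈ Set.Ioo 0 T, HasDerivAt (fun s => F s * (w + T - s) ^ (-β)) 0 s := by
    intro s hs
    have hpos : 0 < w + T - s := by linarith [hs.2]
    have h1 : HasDerivAt (fun s => w + T - s) (-1) s := by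
      simpa using (hasDerivAt_id s).const_sub (w + T)
    have h2 := (hFd s hs).mul (h1.rpow_const (p := -β) (Or.inl hpos.ne'))
    refine h2.congr_deriv ?_
    rw [Real.rpow_sub_one hpos.ne']
    simp only [hζ]
    field_simp
    ring
  obtain ⟨c, -, hc⟩ := exists_hasDerivAt_eq_slope _ (fun _ => 0) hT hGc hGd
  have hEq : F T * (w + T - T) ^ (-β) = F 0 * (w + T - 0) ^ (-β) := by
    rw [eq_comm, div_eq_zero_iff] at hc
    rcases hc with hc | hc <;> linarith
  have hwp : 0 < w ^ (-β) := Real.rpow_pos_of_pos (by linarith) _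
  have hζT : ζ T = 1 - 1 / w := by simp [hζ]
  have hζ00 : ζ 0 = r := by simp [hζ, hr]
  simp only [hF, hζT, hζ00, add_sub_cancel_right, sub_zero] at hEq
  have hdiv : (1 + T / w) ^ (-β) = (w + T) ^ (-β) / w ^ (-β) := by
    rw [← Real.div_rpow (by positivity) (by linarith)]
    congr 1
    field_simp
  rw [hdiv, div_mul_eq_mul_div, eq_div_iff hwp.ne', hEq, mul_comm]

/-! ### Solving the forward equation -/

/-- Bounded coefficients give radius of convergence at least `1`. The sum is known only for `z ≥ 0`,
but these points accumulate at `0`, which suffices for the identity theorem. -/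
theorem eq_iteratedDeriv_of_hasSum {f : ℝ → ℝ} (hf : AnalyticAt ℝ f 0) {c : ℕ → ℝ}
    (hc : ∀ n, |c n| ≤ 1) (h : ∀ z ∈ Set.Ico (0 : ℝ) 1, HasSum (fun n => c n * z ^ n) (f z))
    (n : ℕ) : c n = iteratedDeriv n f 0 / n.factorial := by
  set p := FormalMultilinearSeries.ofScalars ℝ c with hp
  have hrad : (1 : ℝ≥0) ≤ p.radius := by
    refine p.le_radius_of_bound 1 fun n => ?_
    rw [hp, FormalMultilinearSeries.ofScalars_norm]
    simpa using hc n
  have hps := p.hasFPowerSeriesOnBall (lt_of_lt_of_le (by simp) hrad)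
  have hfp : ∃ᶠ z in nhdsWithin (0 : ℝ) {0}ᶜ, f z = p.sum z := by
    have h1 : ∀ᶠ z in nhdsWithin (0 : ℝ) (Set.Ioi 0), f z = p.sum z := by
      filter_upwards [Ioo_mem_nhdsGT (zero_lt_one' ℝ)] with z hz
      rw [← (h z ⟨hz.1.le, hz.2⟩).tsum_eq, hp]
      change _ = FormalMultilinearSeries.ofScalarsSum c z
      rw [FormalMultilinearSeries.ofScalars_sum_eq]
      simp
    exact h1.frequently.filter_mono (nhdsWithin_mono _ fun z hz => (Set.mem_Ioi.1 hz).ne')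
  have hev := (hf.frequently_eq_iff_eventually_eq hps.analyticAt).1 hfp
  have := hf.hasFPowerSeriesAt.eq_formalMultilinearSeries
    (hps.hasFPowerSeriesAt.congr (hev.mono fun _ h => h.symm))
  exact (congrFun (FormalMultilinearSeries.ofScalars_series_injective ℝ ℝ this) n).symm

/-- The region where the generating function `bdPgf` is analytic. -/
def pgfDomain : Set (ℝ × ℝ) := {p | 0 < 1 + p.1 * (1 - p.2)}

theorem isOpen_pgfDomain : IsOpen pgfDomain :=
  isOpen_lt continuous_const (by fun_prop)

/-- The generating function at `z = p.2`, at time `t = p.1`, of the solution of the forward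
equation whose generating function at time `0` is `z ↦ h (1 - z)`. -/
def bdPgf (β : ℝ) (h : ℝ → ℝ) (p : ℝ × ℝ) : ℝ :=
  (1 + p.1 * (1 - p.2)) ^ (-β) * h ((1 - p.2) / (1 + p.1 * (1 - p.2)))

theorem analyticOnNhd_bdPgf (β : ℝ) {h : ℝ → ℝ} (hh : AnalyticOnNhd ℝ h Set.univ) :
    AnalyticOnNhd ℝ (bdPgf β h) pgfDomain := by
  intro p hp
  have hp' : 0 < 1 + p.1 * (1 - p.2) := hp
  have h0 : AnalyticAt ℝ (fun p : ℝ × ℝ => 1 - p.2) p := analyticAt_const.fun_sub analyticAt_snd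
  have h1 : AnalyticAt ℝ (fun p : ℝ × ℝ => 1 + p.1 * (1 - p.2)) p :=
    analyticAt_const.fun_add (analyticAt_fst.fun_mul h0)
  have h2 : AnalyticAt ℝ (fun p : ℝ × ℝ => (1 - p.2) / (1 + p.1 * (1 - p.2))) p :=
    h0.fun_div h1 hp'.ne'
  have h3 : AnalyticAt ℝ (fun p : ℝ × ℝ => (1 + p.1 * (1 - p.2)) ^ (-β)) p := by
    have hlog : AnalyticAt ℝ (fun p : ℝ × ℝ => Real.log (1 + p.1 * (1 - p.2))) p :=
      AnalyticAt.fun_comp (f := fun p : ℝ × ℝ => 1 + p.1 * (1 - p.2)) (analyticAt_log hp') h1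
    refine (analyticAt_rexp.fun_comp (hlog.fun_mul (analyticAt_const (v := -β)))).congr ?_
    filter_upwards [isOpen_pgfDomain.mem_nhds hp] with q hq
    exact (Real.rpow_def_of_pos hq _).symm
  exact h3.fun_mul ((hh _ (Set.mem_univ _)).fun_comp h2)

/-- Iterated partial derivatives in the second variable. -/
def sndDeriv (F : ℝ × ℝ → ℝ) : ℕ → ℝ × ℝ → ℝ
  | 0 => F
  | n + 1 => fun p => fderiv ℝ (sndDeriv F n) p (0, 1)

theorem analyticOnNhd_sndDeriv {F : ℝ × ℝ → ℝ} {U : Set (ℝ × ℝ)} (hF : AnalyticOnNhd ℝ F U)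
    (n : ℕ) : AnalyticOnNhd ℝ (sndDeriv F n) U := by
  induction n with
  | zero => exact hF
  | succ n ih =>
    intro p hp
    exact (ContinuousLinearMap.analyticAt
      (ContinuousLinearMap.apply ℝ ℝ ((0, 1) : ℝ × ℝ)) _).fun_comp (ih.fderiv p hp)

theorem hasDerivAt_snd {F : ℝ × ℝ → ℝ} {p : ℝ × ℝ} (hF : DifferentiableAt ℝ F p) :
    HasDerivAt (fun z => F (p.1, z)) (fderiv ℝ F p (0, 1)) p.2 :=
  HasFDerivAt.comp_hasDerivAt (f := fun z => (p.1, z)) p.2 hF.hasFDerivAt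
    ((hasDerivAt_const p.2 p.1).prodMk (hasDerivAt_id p.2))

theorem hasDerivAt_fst {F : ℝ × ℝ → ℝ} {p : ℝ × ℝ} (hF : DifferentiableAt ℝ F p) :
    HasDerivAt (fun t => F (t, p.2)) (fderiv ℝ F p (1, 0)) p.1 :=
  HasFDerivAt.comp_hasDerivAt (f := fun t => (t, p.2)) p.1 hF.hasFDerivAt
    ((hasDerivAt_id p.1).prodMk (hasDerivAt_const p.1 p.2))

theorem iteratedDeriv_snd {F : ℝ × ℝ → ℝ} {U : Set (ℝ × ℝ)} (hU : IsOpen U)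
    (hF : AnalyticOnNhd ℝ F U) (n : ℕ) {t z : ℝ} (hp : (t, z) ∈ U) :
    iteratedDeriv n (fun z => F (t, z)) z = sndDeriv F n (t, z) := by
  induction n generalizing z with
  | zero => simp [sndDeriv]
  | succ n ih =>
    rw [iteratedDeriv_succ]
    have hev : iteratedDeriv n (fun z => F (t, z)) =ᶠ[nhds z] fun z => sndDeriv F n (t, z) := by
      have : ∀ᶠ y in nhds z, (t, y) ∈ U :=
        (Continuous.continuousAt (by fun_prop : Continuous fun y : ℝ => (t, y))).eventually_mem
          (hU.mem_nhds hp)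
      filter_upwards [this] with y hy using ih hy
    rw [hev.deriv_eq]
    exact (hasDerivAt_snd (p := (t, z))
      (analyticOnNhd_sndDeriv hF n _ hp).differentiableAt).deriv

theorem fderiv_fst_snd_comm {F : ℝ × ℝ → ℝ} {p : ℝ × ℝ} (hF : AnalyticAt ℝ F p) :
    fderiv ℝ (fun q => fderiv ℝ F q (0, 1)) p (1, 0) =
      fderiv ℝ (fun q => fderiv ℝ F q (1, 0)) p (0, 1) := by
  have hs : IsSymmSndFDerivAt ℝ F p :=
    (hF.contDiffAt (n := 2)).isSymmSndFDerivAt (by simp)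
  have hd : DifferentiableAt ℝ (fderiv ℝ F) p := hF.fderiv.differentiableAt
  have h (v w : ℝ × ℝ) : fderiv ℝ (fun q => fderiv ℝ F q v) p w =
      fderiv ℝ (fderiv ℝ F) p w v := by
    rw [fderiv_clm_apply hd (by fun_prop)]
    simp
  rw [h, h]
  exact hs _ _

/-- The transport equation for the explicit solution: `1/(1-z) + t` is constant along
characteristics, and `h` is evaluated at its reciprocal. -/
theorem fderiv_fst_bdPgf (β : ℝ) {h : ℝ → ℝ} (hh : AnalyticOnNhd ℝ h Set.univ) {p : ℝ × ℝ}
    (hp : p ∈ pgfDomain) : fderiv ℝ (bdPgf β h) p (1, 0) =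
      (1 - p.2) ^ 2 * fderiv ℝ (bdPgf β h) p (0, 1) - β * (1 - p.2) * bdPgf β h p := by
  obtain ⟨t, z⟩ := p
  have hA : 0 < 1 + t * (1 - z) := hp
  have hd := (analyticOnNhd_bdPgf β hh _ hp).differentiableAt
  set m := (1 - z) / (1 + t * (1 - z)) with hm
  have hhd : HasDerivAt h (deriv h m) m := (hh m (Set.mem_univ _)).differentiableAt.hasDerivAt
  have a1 : HasDerivAt (fun s => 1 + s * (1 - z)) (1 - z) t := by
    simpa using ((hasDerivAt_id t).mul_const (1 - z)).const_add 1
  have a2 : HasDerivAt (fun y => 1 + t * (1 - y)) (-t) z := by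
    simpa using (((hasDerivAt_id z).const_sub 1).const_mul t).const_add 1
  have a3 : HasDerivAt (fun y => 1 - y) (-1) z := by
    simpa using (hasDerivAt_id z).const_sub 1
  have d1 := (a1.rpow_const (p := -β) (Or.inl hA.ne')).mul
    (HasDerivAt.comp t hhd ((hasDerivAt_const t (1 - z)).div a1 hA.ne'))
  have d2 := (a2.rpow_const (p := -β) (Or.inl hA.ne')).mul
    (HasDerivAt.comp z hhd (a3.div a2 hA.ne'))
  rw [(hasDerivAt_fst (p := (t, z)) hd).unique d1, (hasDerivAt_snd (p := (t, z)) hd).unique d2,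
    bdPgf]
  simp only [Function.comp_apply, Pi.div_apply, ← hm, Real.rpow_sub_one hA.ne']
  generalize hAe : 1 + t * (1 - z) = A at hA ⊢
  have hne := hA.ne'
  field_simp
  rw [← hAe]
  ring

/-- Leibniz's rule applied to the transport equation; its coefficients have degree at most two in
`z`, so the expansion stops. At `z = 0`, after division by `n!`, it is the forward equation. -/
theorem fderiv_fst_sndDeriv_bdPgf (β : ℝ) {h : ℝ → ℝ} (hh : AnalyticOnNhd ℝ h Set.univ) (n : ℕ)
    {p : ℝ × ℝ} (hp : p ∈ pgfDomain) : fderiv ℝ (sndDeriv (bdPgf β h) n) p (1, 0) =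
      (1 - p.2) ^ 2 * sndDeriv (bdPgf β h) (n + 1) p -
        2 * n * (1 - p.2) * sndDeriv (bdPgf β h) n p +
        n * (n - 1) * sndDeriv (bdPgf β h) (n - 1) p -
        β * (1 - p.2) * sndDeriv (bdPgf β h) n p + β * n * sndDeriv (bdPgf β h) (n - 1) p := by
  induction n generalizing p with
  | zero => simpa [sndDeriv] using fderiv_fst_bdPgf β hh hp
  | succ n ih =>
    have hA (k : ℕ) := analyticOnNhd_sndDeriv (analyticOnNhd_bdPgf β hh) k p hp
    have hcomm := fderiv_fst_snd_comm (hA n)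
    have hev : (fun q => fderiv ℝ (sndDeriv (bdPgf β h) n) q (1, 0)) =ᶠ[nhds p] _ :=
      Filter.eventually_of_mem (isOpen_pgfDomain.mem_nhds hp) fun q hq => ih hq
    have hd : DifferentiableAt ℝ (fun q => fderiv ℝ (sndDeriv (bdPgf β h) n) q (1, 0)) p :=
      ((ContinuousLinearMap.analyticAt (ContinuousLinearMap.apply ℝ ℝ ((1, 0) : ℝ × ℝ))
        _).fun_comp (hA n).fderiv).differentiableAt
    have hz (k : ℕ) : HasDerivAt (fun z => sndDeriv (bdPgf β h) k (p.1, z))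
        (sndDeriv (bdPgf β h) (k + 1) p) p.2 := hasDerivAt_snd (hA k).differentiableAt
    have a3 : HasDerivAt (fun y => 1 - y) (-1) p.2 := by
      simpa using (hasDerivAt_id p.2).const_sub 1
    have hline : Filter.Tendsto (fun z => (p.1, z)) (nhds p.2) (nhds p) :=
      (by fun_prop : Continuous fun z : ℝ => (p.1, z)).tendsto p.2
    have hev2 := hev.comp_tendsto hline
    have D := (((((a3.pow 2).mul (hz (n + 1))).sub ((a3.const_mul (2 * (n : ℝ))).mul (hz n))).add
      ((hz (n - 1)).const_mul ((n : ℝ) * (n - 1)))).sub ((a3.const_mul β).mul (hz n))).add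
      ((hz (n - 1)).const_mul (β * n))
    have E := (hasDerivAt_snd hd).unique (D.congr_of_eventuallyEq hev2)
    have hL : fderiv ℝ (sndDeriv (bdPgf β h) (n + 1)) p (1, 0) =
      fderiv ℝ (fun q => fderiv ℝ (sndDeriv (bdPgf β h) n) q (0, 1)) p (1, 0) := rfl
    rw [hL, hcomm, E]
    -- Truncated subtraction gives the wrong index at `n = 0`, where the factor `n` vanishes.
    have hn : (n : ℝ) * sndDeriv (bdPgf β h) (n - 1 + 1) p = n * sndDeriv (bdPgf β h) n p := by
      cases n <;> simp
    simp only [Nat.add_sub_cancel, Pi.pow_apply, Prod.mk.eta]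
    push_cast
    linear_combination ((n : ℝ) - 1 + β) * hn

/-- Sequences with generating function `bdPgf β h (t, ·)` solve the forward equation. -/
theorem hasDerivWithinAt_of_hasSum_bdPgf {β : ℝ} {h : ℝ → ℝ} (hh : AnalyticOnNhd ℝ h Set.univ)
    {u : ℝ → ℕ → ℝ} (hu : ∀ t n, |u t n| ≤ 1)
    (hs : ∀ t, 0 ≤ t → ∀ z ∈ Set.Ico (0 : ℝ) 1, HasSum (fun n => u t n * z ^ n) (bdPgf β h (t, z)))
    (n : ℕ) {t : ℝ} (ht : 0 ≤ t) :
    HasDerivWithinAt (fun s => u s n) (forward β (u t) n) (Set.Ici 0) t := by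
  have hmem (t : ℝ) (ht : 0 ≤ t) : (t, (0 : ℝ)) ∈ pgfDomain := by
    change 0 < 1 + t * (1 - 0); linarith
  have hA := analyticOnNhd_bdPgf β hh
  have hun (t : ℝ) (ht : 0 ≤ t) (n : ℕ) :
      u t n = sndDeriv (bdPgf β h) n (t, 0) / n.factorial := by
    rw [← iteratedDeriv_snd isOpen_pgfDomain hA n (hmem t ht)]
    refine eq_iteratedDeriv_of_hasSum ?_ (hu t) (hs t ht) n
    exact (hA _ (hmem t ht)).fun_comp (g := bdPgf β h) (f := fun z => (t, z)) (by fun_prop)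
  -- The explicit function is also defined for slightly negative times, so it has a two-sided
  -- derivative even at `t = 0`; the sequence agrees with it only on `t ≥ 0`.
  have hd := hasDerivAt_fst (analyticOnNhd_sndDeriv hA n _ (hmem t ht)).differentiableAt
  rw [fderiv_fst_sndDeriv_bdPgf β hh n (hmem t ht)] at hd
  refine ((hd.div_const (n.factorial : ℝ)).hasDerivWithinAt.congr
    (fun s hs => hun s hs n) (hun t ht n)).congr_deriv ?_
  cases n with
  | zero => simp [forward, hun t ht]
  | succ n =>
    simp only [forward, hun t ht, Nat.add_sub_cancel, Nat.factorial_succ]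
    push_cast
    field_simp
    ring

/-! ### Kernels acting on exponential families -/

/-- A family of functions that behaves like `e^{-l x}` or `(1 - l)^n`, for `l ∈ [0, 1]`. -/
structure IsExpFamily {E : Type} [MeasurableSpace E] (φ : ℝ → E → ℝ) : Prop where
  measurable : ∀ l, Measurable (φ l)
  nonneg : ∀ l ∈ Set.Icc (0 : ℝ) 1, ∀ x, 0 ≤ φ l x
  le_one : ∀ l ∈ Set.Icc (0 : ℝ) 1, ∀ x, φ l x ≤ 1
  zero : ∀ x, φ 0 x = 1
  ext : ∀ (μ μ' : Measure E) [IsFiniteMeasure μ] [IsFiniteMeasure μ'],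
    (∀ l ∈ Set.Ioc (0 : ℝ) 1, ∫⁻ x, ENNReal.ofReal (φ l x) ∂μ = ∫⁻ x, ENNReal.ofReal (φ l x) ∂μ') →
      μ = μ'

theorem isExpFamily_expFun : IsExpFamily expFun where
  measurable := measurable_expFun
  nonneg l _ x := (expFun_pos l x).le
  le_one _ hl x := expFun_le_one hl.1 x
  zero x := by simp [expFun]
  ext _ _ _ _ h := measure_ext_of_lintegral_expFun h

theorem isExpFamily_geomFun : IsExpFamily geomFun where
  measurable := measurable_geomFun
  nonneg _ hl n := geomFun_nonneg hl.2 n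
  le_one _ hl n := geomFun_le_one hl.2 hl.1 n
  zero n := by simp [geomFun]
  ext _ _ _ _ h := measure_ext_of_lintegral_geomFun h

/-- The kernel `κ` maps `φ l` to `(1 + a l)^{-β} φ (c l / (1 + a l))` for `l ∈ [0, 1]`. -/
def HasTransform {E : Type} [MeasurableSpace E] (φ : ℝ → E → ℝ) (β a c : ℝ) (κ : Kernel E E) :
    Prop :=
  ∀ x, ∀ l ∈ Set.Icc (0 : ℝ) 1, ∫⁻ y, ENNReal.ofReal (φ l y) ∂(κ x) =
    ENNReal.ofReal ((1 + a * l) ^ (-β) * φ (c * l / (1 + a * l)) x)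

theorem div_one_add_mem_Icc {a c l : ℝ} (ha : 0 ≤ a) (hc : 0 ≤ c) (hc1 : c ≤ 1)
    (hl : l ∈ Set.Icc (0 : ℝ) 1) : c * l / (1 + a * l) ∈ Set.Icc (0 : ℝ) 1 := by
  have h0 : 0 ≤ a * l := mul_nonneg ha hl.1
  have h1 : 0 ≤ c * l := mul_nonneg hc hl.1
  have h2 : c * l ≤ 1 := mul_le_one₀ hc1 hl.1 hl.2
  refine ⟨by positivity, ?_⟩
  rw [div_le_one (by linarith)]
  linarith

section IsExpFamily

variable {E : Type} [MeasurableSpace E] {φ : ℝ → E → ℝ}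

theorem IsExpFamily.integrable (hφ : IsExpFamily φ) {μ : Measure E} [IsFiniteMeasure μ] {l : ℝ}
    (hl : l ∈ Set.Icc (0 : ℝ) 1) : Integrable (φ l) μ :=
  Integrable.of_bound (hφ.measurable l).aestronglyMeasurable 1 (ae_of_all _ fun x => by
    rw [Real.norm_of_nonneg (hφ.nonneg l hl x)]; exact hφ.le_one l hl x)

theorem IsExpFamily.lintegral_eq (hφ : IsExpFamily φ) {μ : Measure E} [IsFiniteMeasure μ] {l : ℝ}
    (hl : l ∈ Set.Icc (0 : ℝ) 1) :
    ∫⁻ x, ENNReal.ofReal (φ l x) ∂μ = ENNReal.ofReal (∫ x, φ l x ∂μ) :=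
  (ofReal_integral_eq_lintegral_ofReal (hφ.integrable hl) (ae_of_all _ (hφ.nonneg l hl))).symm

theorem HasTransform.integral {β a c : ℝ} {κ : Kernel E E} (hφ : IsExpFamily φ) (ha : 0 ≤ a)
    (hc : 0 ≤ c) (hc1 : c ≤ 1) (h : HasTransform φ β a c κ) (x : E) {l : ℝ}
    (hl : l ∈ Set.Icc (0 : ℝ) 1) :
    ∫ y, φ l y ∂(κ x) = (1 + a * l) ^ (-β) * φ (c * l / (1 + a * l)) x := by
  rw [integral_eq_lintegral_of_nonneg_ae (ae_of_all _ (hφ.nonneg l hl))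
    (hφ.measurable l).aestronglyMeasurable, h x l hl, ENNReal.toReal_ofReal]
  have := hφ.nonneg _ (div_one_add_mem_Icc ha hc hc1 hl) x
  have := mul_nonneg ha hl.1
  positivity

theorem HasTransform.isMarkovKernel {β a c : ℝ} {κ : Kernel E E} (hφ : IsExpFamily φ)
    (h : HasTransform φ β a c κ) : IsMarkovKernel κ :=
  ⟨fun x => ⟨by simpa [hφ.zero] using h x 0 ⟨le_rfl, zero_le_one⟩⟩⟩

/-- The maps `l ↦ l/(1+tl)` compose additively in `t`, and the factors `1+tl` form the matching
multiplicative cocycle. The value `l = 0` gives total mass one. -/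
theorem isMarkovSemigroup_of_hasTransform {β : ℝ} {P : ℝ≥0 → Kernel E E} (hφ : IsExpFamily φ)
    (h : ∀ t : ℝ≥0, HasTransform φ β (t : ℝ) 1 (P t)) : IsMarkovSemigroup P where
  isMarkovKernel t := (h t).isMarkovKernel hφ
  zero := by
    have := (h 0).isMarkovKernel hφ
    ext1 x
    refine hφ.ext _ _ fun l hl => ?_
    rw [h 0 x l ⟨hl.1.le, hl.2⟩, Kernel.id_apply, lintegral_dirac' _ (hφ.measurable l).ennreal_ofReal]
    simp
  add s t := by
    have := (h (s + t)).isMarkovKernel hφ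
    have := (h s).isMarkovKernel hφ
    have := (h t).isMarkovKernel hφ
    ext1 x
    refine hφ.ext _ _ fun l hl => ?_
    have hl' : l ∈ Set.Icc (0 : ℝ) 1 := ⟨hl.1.le, hl.2⟩
    have hl0 := hl.1
    have hm := div_one_add_mem_Icc (NNReal.coe_nonneg t) zero_le_one le_rfl hl'
    have hA : 0 < 1 + (t : ℝ) * l := by positivity
    rw [h _ x l hl', Kernel.lintegral_comp _ _ _ (hφ.measurable l).ennreal_ofReal]
    simp only [h t _ l hl', ENNReal.ofReal_mul (Real.rpow_nonneg hA.le _)]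
    rw [lintegral_const_mul _ (hφ.measurable _).ennreal_ofReal, h s x _ hm,
      ← ENNReal.ofReal_mul (Real.rpow_nonneg hA.le _), ← mul_assoc, ← Real.mul_rpow hA.le
        (by have := hm.1; have := NNReal.coe_nonneg s; positivity)]
    have e1 : (1 + (t : ℝ) * l) * (1 + s * (1 * l / (1 + t * l))) = 1 + (s + t) * l := by
      field_simp
      ring
    have e2 : 1 * (1 * l / (1 + (t : ℝ) * l)) / (1 + s * (1 * l / (1 + t * l))) =
        1 * l / (1 + (s + t) * l) := by
      rw [← e1]
      field_simp
    rw [e1, e2, NNReal.coe_add]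

end IsExpFamily

/-! ### Explicit transition kernels -/

/-- Explicit transition kernels of the squared Bessel process: Poisson mixtures of gamma laws. -/
def besselKernel (β : ℝ) (t : ℝ≥0) : Kernel ℝ≥0 ℝ≥0 :=
  if t = 0 then Kernel.id else
    (Kernel.ofFunOfCountable fun n : ℕ => gammaLaw (β + n) t) ∘ₖ scaledPoissonKernel (t : ℝ)⁻¹

/-- A gamma law of shape `β + n` contributes `(1+tl)^{-β}` times a geometric function of `n`, which
the Poisson law of parameter `x/t` averages to an exponential in `x`. -/
theorem hasTransform_besselKernel {β : ℝ} (hβ : 0 < β) (t : ℝ≥0) :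
    HasTransform expFun β t 1 (besselKernel β t) := by
  intro x l hl
  rcases eq_or_ne t 0 with rfl | ht
  · rw [besselKernel, if_pos rfl, Kernel.id_apply, lintegral_dirac' _ (by fun_prop)]
    simp
  have ht0 : 0 < (t : ℝ) := by positivity
  have hl0 := hl.1
  have hA : 0 < 1 + (t : ℝ) * l := by positivity
  rw [besselKernel, if_neg ht, Kernel.lintegral_comp _ _ _ (by fun_prop)]
  have h1 (n : ℕ) : ∫⁻ y, ENNReal.ofReal (expFun l y)
      ∂((Kernel.ofFunOfCountable fun n : ℕ => gammaLaw (β + n) t) n) =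
      ENNReal.ofReal ((1 + t * l) ^ (-β)) * ENNReal.ofReal (geomFun (t * l / (1 + t * l)) n) := by
    change ∫⁻ y, ENNReal.ofReal (expFun l y) ∂(gammaLaw (β + n) t) = _
    rw [lintegral_gammaLaw_expFun (by positivity) ht0 hl.1,
      ← ENNReal.ofReal_mul (Real.rpow_nonneg hA.le _)]
    congr 1
    rw [geomFun, show 1 - t * l / (1 + t * l) = (1 + t * l)⁻¹ by field_simp; ring, neg_add,
      Real.rpow_add hA, Real.rpow_neg hA.le (n : ℝ), Real.rpow_natCast, inv_pow]
  simp only [h1]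
  rw [lintegral_const_mul _ (by fun_prop), lintegral_scaledPoissonKernel_geomFun (by positivity) _
    (by rw [div_le_one hA]; linarith), ← ENNReal.ofReal_mul (Real.rpow_nonneg hA.le _)]
  congr 3
  field_simp

/-- Explicit transition kernels of the linear birth-death chain: the individuals alive at time `0`
are thinned, and the survivors and the immigrants have a negative binomial progeny. -/
def birthDeathKernel (β : ℝ) (t : ℝ≥0) : Kernel ℕ ℕ :=
  if t = 0 then Kernel.id else
    (Kernel.ofFunOfCountable fun k : ℕ => (negBinomialLaw (β + k) t).map (· + k)) ∘ₖ
      thinning (1 / (1 + t))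

/-- Each survivor contributes the factor `(1-l)/(1+tl)`, so the conditional transform is geometric
in the number of survivors; thinning then rescales its parameter. -/
theorem hasTransform_birthDeathKernel {β : ℝ} (hβ : 0 < β) (t : ℝ≥0) :
    HasTransform geomFun β t 1 (birthDeathKernel β t) := by
  intro x l hl
  rcases eq_or_ne t 0 with rfl | ht
  · rw [birthDeathKernel, if_pos rfl, Kernel.id_apply, lintegral_dirac' _ (by fun_prop)]
    simp
  have ht0 : 0 < (t : ℝ) := by positivity
  have hl0 := hl.1
  have hA : 0 < 1 + (t : ℝ) * l := by positivity
  rw [birthDeathKernel, if_neg ht, Kernel.lintegral_comp _ _ _ (by fun_prop)]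
  have h1 (k : ℕ) : ∫⁻ y, ENNReal.ofReal (geomFun l y)
      ∂((Kernel.ofFunOfCountable fun k : ℕ => (negBinomialLaw (β + k) t).map (· + k)) k) =
      ENNReal.ofReal ((1 + t * l) ^ (-β)) *
        ENNReal.ofReal (geomFun ((1 + t) * l / (1 + t * l)) k) := by
    change ∫⁻ y, ENNReal.ofReal (geomFun l y) ∂((negBinomialLaw (β + k) t).map (· + k)) = _
    rw [lintegral_map (by fun_prop) (by fun_prop)]
    simp only [geomFun, pow_add]
    simp only [ENNReal.ofReal_mul' (pow_nonneg (sub_nonneg.2 hl.2) k)]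
    rw [lintegral_mul_const _ (measurable_of_countable _)]
    change (∫⁻ y, ENNReal.ofReal (geomFun l y) ∂(negBinomialLaw (β + k) t)) * _ = _
    rw [lintegral_negBinomialLaw_geomFun (by positivity) ht0 hl.1 hl.2,
      ← ENNReal.ofReal_mul (Real.rpow_nonneg hA.le _),
      ← ENNReal.ofReal_mul (Real.rpow_nonneg hA.le _)]
    congr 1
    rw [show 1 - (1 + t) * l / (1 + t * l) = (1 - l) * (1 + t * l)⁻¹ by field_simp; ring, neg_add,
      Real.rpow_add hA, Real.rpow_neg hA.le (k : ℝ), Real.rpow_natCast, mul_pow, inv_pow]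
    ring
  simp only [h1]
  rw [lintegral_const_mul _ (by fun_prop), lintegral_thinning_geomFun (by positivity)
    (by rw [div_le_one (by positivity)]; linarith) _
    (by rw [div_le_one hA]; linarith [hl.2]), ← ENNReal.ofReal_mul (Real.rpow_nonneg hA.le _)]
  congr 3
  field_simp

/-! ### Generators and the forward equation -/

theorem hasSum_real_singleton_mul_pow (m : Measure ℕ) [IsProbabilityMeasure m] {l : ℝ}
    (hl : l ∈ Set.Ioc (0 : ℝ) 1) :
    HasSum (fun n => m.real {n} * (1 - l) ^ n) (∫ n, geomFun l n ∂m) := by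
  have hs : Summable fun n => m.real {n} * (1 - l) ^ n :=
    summable_mul_pow (fun n => by rw [abs_of_nonneg measureReal_nonneg]; exact measureReal_le_one)
      (by linarith [hl.2]) (by linarith [hl.1])
  rw [integral_countable (isExpFamily_geomFun.integrable ⟨hl.1.le, hl.2⟩)]
  exact hs.hasSum

theorem integral_geomFun_of_forward {β : ℝ} (hβ : 0 < β) {m : ℝ → Measure ℕ}
    [∀ t, IsProbabilityMeasure (m t)]
    (hf : ∀ n t, 0 ≤ t → HasDerivWithinAt (fun s => (m s).real {n})
      (forward β (fun k => (m t).real {k}) n) (Set.Ici 0) t)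
    {t : ℝ} (ht : 0 ≤ t) {l : ℝ} (hl : l ∈ Set.Ioc (0 : ℝ) 1) :
    ∫ n, geomFun l n ∂(m t) = (1 + t * l) ^ (-β) * ∫ n, geomFun (l / (1 + t * l)) n ∂(m 0) := by
  have hl0 := hl.1
  have h := tsum_mul_pow_of_forward hβ (u := fun t n => (m t).real {n})
    (fun t n => by rw [abs_of_nonneg measureReal_nonneg]; exact measureReal_le_one) hf ht
    -- With `w = 1/l` the final point `1 - 1/w` is `1 - l`, and `1 - 1/(w+t)` has parameter
    -- `l/(1+tl)`.
    (w := 1 / l) (by rw [le_div_iff₀ hl0]; linarith [hl.2])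
  have hl' : l / (1 + t * l) ∈ Set.Ioc (0 : ℝ) 1 := by
    have : 0 ≤ t * l := by positivity
    refine ⟨by positivity, ?_⟩
    rw [div_le_one (by positivity)]
    linarith [hl.2]
  rw [← (hasSum_real_singleton_mul_pow _ hl).tsum_eq,
    ← (hasSum_real_singleton_mul_pow _ hl').tsum_eq]
  rw [show 1 / (1 / l) = l by field_simp, show t / (1 / l) = t * l by field_simp,
    show 1 / (1 / l + t) = l / (1 + t * l) by field_simp] at h
  exact h

theorem forward_of_integral_geomFun {β : ℝ} {h : ℝ → ℝ} (hh : AnalyticOnNhd ℝ h Set.univ)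
    {m : ℝ → Measure ℕ} [∀ t, IsProbabilityMeasure (m t)]
    (hm : ∀ t, 0 ≤ t → ∀ l ∈ Set.Ioc (0 : ℝ) 1,
      ∫ n, geomFun l n ∂(m t) = (1 + t * l) ^ (-β) * h (l / (1 + t * l)))
    (n : ℕ) {t : ℝ} (ht : 0 ≤ t) :
    HasDerivWithinAt (fun s => (m s).real {n})
      (forward β (fun k => (m t).real {k}) n) (Set.Ici 0) t := by
  refine hasDerivWithinAt_of_hasSum_bdPgf (u := fun t n => (m t).real {n}) hh
    (fun t n => by rw [abs_of_nonneg measureReal_nonneg]; exact measureReal_le_one)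
    (fun t ht z hz => ?_) n ht
  have hl : 1 - z ∈ Set.Ioc (0 : ℝ) 1 := ⟨by linarith [hz.2], by linarith [hz.1]⟩
  have := hasSum_real_singleton_mul_pow (m t) hl
  rwa [hm t ht _ hl, sub_sub_cancel] at this

theorem birthDeathOp_add (β : ℝ) (f g : ℕ → ℝ) :
    birthDeathOp β (f + g) = birthDeathOp β f + birthDeathOp β g := by
  funext n
  simp only [birthDeathOp, Pi.add_apply]
  ring

theorem birthDeathOp_smul (β c : ℝ) (g : ℕ → ℝ) :
    birthDeathOp β (c • g) = c • birthDeathOp β g := by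
  funext n
  simp only [birthDeathOp, Pi.smul_apply, smul_eq_mul]
  ring

/-- `forward` is the transpose of the generator, so testing Kolmogorov's equation on point masses
yields the forward equation. -/
theorem birthDeathOp_single (β : ℝ) (n k : ℕ) :
    birthDeathOp β (Pi.single n 1) k = forward β (fun j => (Pi.single j 1 : ℕ → ℝ) k) n := by
  cases n with
  | zero =>
    simp only [birthDeathOp, forward, Pi.single_apply]
    rcases k with _ | _ | k <;> simp
  | succ n =>
    simp only [birthDeathOp, forward, Pi.single_apply]
    rcases k with _ | k
    · rcases n with _ | n <;> simp
    · simp only [Nat.add_sub_cancel]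
      split_ifs <;> first | omega | (subst_vars; push_cast; ring; done) |
        (obtain rfl : k = n := by omega
         push_cast; ring)

theorem integrable_single (m : Measure ℕ) [IsFiniteMeasure m] (n : ℕ) :
    Integrable (Pi.single n 1 : ℕ → ℝ) m :=
  Integrable.of_bound (measurable_of_countable _).aestronglyMeasurable 1 (ae_of_all _ fun k => by
    rw [Pi.single_apply]; split_ifs <;> simp)

theorem integral_single (m : Measure ℕ) (n : ℕ) :
    ∫ k, (Pi.single n 1 : ℕ → ℝ) k ∂m = m.real {n} := by
  rw [← integral_indicator_one (measurableSet_singleton n)]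
  refine integral_congr_ae (ae_of_all _ fun k => ?_)
  simp [Pi.single_apply, Set.indicator_apply]

theorem integrable_forward {E : Type} [MeasurableSpace E] {μ : Measure E} (β : ℝ) {f : ℕ → E → ℝ}
    (hf : ∀ n, Integrable (f n) μ) (n : ℕ) : Integrable (fun x => forward β (fun j => f j x) n) μ := by
  cases n with
  | zero => exact (hf 1).sub ((hf 0).const_mul β)
  | succ n =>
    exact (((hf n).const_mul _).add ((hf (n + 2)).const_mul _)).sub ((hf (n + 1)).const_mul _)

theorem integral_forward {E : Type} [MeasurableSpace E] {μ : Measure E} (β : ℝ) {f : ℕ → E → ℝ}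
    (hf : ∀ n, Integrable (f n) μ) (n : ℕ) :
    ∫ x, forward β (fun j => f j x) n ∂μ = forward β (fun j => ∫ x, f j x ∂μ) n := by
  cases n with
  | zero =>
    simp only [forward]
    rw [integral_sub (hf 1) ((hf 0).const_mul β), integral_const_mul]
  | succ n =>
    simp only [forward]
    rw [integral_sub (f := fun x => (n + β) * f n x + (n + 2) * f (n + 2) x)
      (((hf n).const_mul _).add ((hf (n + 2)).const_mul _))
      ((hf (n + 1)).const_mul _), integral_add ((hf n).const_mul _) ((hf (n + 2)).const_mul _),
      integral_const_mul, integral_const_mul, integral_const_mul]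

/-- Kolmogorov's equation for the birth-death chain, along a family of laws. -/
theorem kolmogorov_birthDeath_of_forward {β : ℝ} {m : ℝ → Measure ℕ}
    [∀ t, IsFiniteMeasure (m t)] {t : ℝ}
    (hf : ∀ n, HasDerivWithinAt (fun s => (m s).real {n})
      (forward β (fun k => (m t).real {k}) n) (Set.Ici 0) t) (g : ℕ →₀ ℝ) :
    (∀ s, Integrable g (m s)) ∧ Integrable (birthDeathOp β g) (m t) ∧
    HasDerivWithinAt (fun s => ∫ n, g n ∂(m s)) (∫ n, birthDeathOp β g n ∂(m t)) (Set.Ici 0) t := by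
  induction g using Finsupp.induction_linear with
  | zero =>
    have h0 : birthDeathOp β ⇑(0 : ℕ →₀ ℝ) = 0 := by funext n; simp [birthDeathOp]
    rw [h0]
    refine ⟨fun s => integrable_zero _ _ _, integrable_zero _ _ _, ?_⟩
    simpa using hasDerivWithinAt_const t (Set.Ici 0) (0 : ℝ)
  | add f g ihf ihg =>
    rw [Finsupp.coe_add, birthDeathOp_add]
    refine ⟨fun s => (ihf.1 s).add (ihg.1 s), ihf.2.1.add ihg.2.1, ?_⟩
    simp only [Pi.add_apply]
    rw [integral_add ihf.2.1 ihg.2.1]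
    exact (ihf.2.2.add ihg.2.2).congr (fun s _ => integral_add (ihf.1 s) (ihg.1 s))
      (integral_add (ihf.1 t) (ihg.1 t))
  | single n c =>
    have hs : ⇑(Finsupp.single n c) = c • (Pi.single n 1 : ℕ → ℝ) := by
      funext k; simp [Finsupp.single_apply, Pi.single_apply, eq_comm]
    have hop : birthDeathOp β (Pi.single n 1) =
        fun k => forward β (fun j => (Pi.single j 1 : ℕ → ℝ) k) n := by
      funext k; exact birthDeathOp_single β n k
    have hi := integrable_forward β (μ := m t) (fun n => integrable_single (m t) n) n
    rw [hs, birthDeathOp_smul, hop]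
    refine ⟨fun s => (integrable_single _ n).smul c, hi.smul c, ?_⟩
    simp only [Pi.smul_apply, smul_eq_mul, integral_const_mul, integral_single]
    rw [integral_forward β (fun n => integrable_single (m t) n) n]
    simp only [integral_single]
    exact (hf n).const_mul c

theorem forward_of_isGeneratedBy_birthDeathGraph {β : ℝ} {P : ℝ≥0 → Kernel ℕ ℕ}
    (hP : IsGeneratedBy P (birthDeathGraph β)) (x n : ℕ) {t : ℝ} (ht : 0 ≤ t) :
    HasDerivWithinAt (fun s : ℝ => (P s.toNNReal x).real {n})
      (forward β (fun k => (P t.toNNReal x).real {k}) n) (Set.Ici 0) t := by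
  have := hP.isMarkovSemigroup.isMarkovKernel
  have h := hP.kolmogorov (Pi.single n 1, birthDeathOp β (Pi.single n 1))
    ⟨(Set.finite_singleton n).subset Pi.support_single_subset, rfl⟩ x t ht
  simp only [integral_single, birthDeathOp_single] at h
  rw [integral_forward β (fun n => integrable_single _ n) n] at h
  simpa only [integral_single] using h

/-- Needed for an arbitrary semigroup with this generator, because `birthDeathSemigroup` is a choice
among all of them. -/
theorem hasTransform_of_isGeneratedBy_birthDeathGraph {β : ℝ} (hβ : 0 < β)
    {P : ℝ≥0 → Kernel ℕ ℕ} (hP : IsGeneratedBy P (birthDeathGraph β)) (t : ℝ≥0) :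
    HasTransform geomFun β t 1 (P t) := by
  have := hP.isMarkovSemigroup.isMarkovKernel
  intro x l hl
  rcases hl.1.eq_or_lt with rfl | hl0
  · simp [geomFun]
  have h := integral_geomFun_of_forward hβ (m := fun s : ℝ => P s.toNNReal x)
    (fun n t ht => forward_of_isGeneratedBy_birthDeathGraph hP x n ht) (NNReal.coe_nonneg t) ⟨hl0, hl.2⟩
  rw [Real.toNNReal_zero, hP.isMarkovSemigroup.zero, Kernel.id_apply, integral_dirac,
    Real.toNNReal_coe] at h
  rw [isExpFamily_geomFun.lintegral_eq hl, one_mul, ← h]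

theorem isGeneratedBy_birthDeathKernel {β : ℝ} (hβ : 0 < β) :
    IsGeneratedBy (birthDeathKernel β) (birthDeathGraph β) where
  isMarkovSemigroup :=
    isMarkovSemigroup_of_hasTransform isExpFamily_geomFun (hasTransform_birthDeathKernel hβ)
  kolmogorov := by
    rintro ⟨g, g'⟩ ⟨hg, hg'⟩ x t ht
    change g' = birthDeathOp β g at hg'
    subst hg'
    have (t : ℝ≥0) := (hasTransform_birthDeathKernel hβ t).isMarkovKernel isExpFamily_geomFun
    refine (kolmogorov_birthDeath_of_forward (m := fun s : ℝ => birthDeathKernel β s.toNNReal x)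
      (fun n => ?_) (Finsupp.ofSupportFinite g hg)).2.2
    refine forward_of_integral_geomFun (h := fun l => geomFun l x) ?_ (fun s hs l hl => ?_) n ht
    · intro l _
      exact (analyticAt_const.fun_sub analyticAt_id).fun_pow x
    · rw [(hasTransform_birthDeathKernel hβ _).integral isExpFamily_geomFun (NNReal.coe_nonneg _)
        zero_le_one le_rfl x ⟨hl.1.le, hl.2⟩, Real.coe_toNNReal s hs, one_mul]

/-! ### The squared Bessel generator on Poisson weights -/

theorem poissonWeight_nonneg (n : ℕ) {x : ℝ} (hx : 0 ≤ x) : 0 ≤ poissonWeight n x := by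
  unfold poissonWeight; positivity

theorem poissonWeight_le_one (n : ℕ) {x : ℝ} (hx : 0 ≤ x) : poissonWeight n x ≤ 1 := by
  rw [poissonWeight, mul_div_right_comm, Real.exp_neg, ← div_eq_mul_inv, div_le_one (Real.exp_pos x)]
  exact Real.pow_div_factorial_le_exp x hx n

@[fun_prop]
theorem continuous_poissonWeight (n : ℕ) : Continuous (poissonWeight n) := by
  unfold poissonWeight; fun_prop

theorem integrable_poissonWeight (μ : Measure ℝ≥0) [IsFiniteMeasure μ] (n : ℕ) :
    Integrable (fun x : ℝ≥0 => poissonWeight n x) μ :=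
  Integrable.of_bound (Measurable.aestronglyMeasurable (by fun_prop)) 1 (ae_of_all _ fun x => by
    rw [Real.norm_of_nonneg (poissonWeight_nonneg n x.coe_nonneg)]
    exact poissonWeight_le_one n x.coe_nonneg)

theorem mul_poissonWeight (n : ℕ) (x : ℝ) :
    x * poissonWeight n x = (n + 1) * poissonWeight (n + 1) x := by
  rw [poissonWeight, poissonWeight, Nat.factorial_succ]
  push_cast
  field_simp
  ring

theorem deriv_poissonWeight_zero : deriv (poissonWeight 0) = fun x => -poissonWeight 0 x := by
  funext x
  have h := (hasDerivAt_id x).neg.exp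
  have h2 : poissonWeight 0 = fun x => Real.exp (-x) := by funext x; simp [poissonWeight]
  rw [h2]
  simpa using h.deriv

theorem deriv_poissonWeight_succ (n : ℕ) : deriv (poissonWeight (n + 1)) =
    fun x => poissonWeight n x - poissonWeight (n + 1) x := by
  funext x
  have h := (((hasDerivAt_id x).pow (n + 1)).mul (hasDerivAt_id x).neg.exp).div_const
    ((n + 1).factorial : ℝ)
  refine (HasDerivAt.deriv (f := poissonWeight (n + 1)) h).trans ?_
  simp only [poissonWeight, Nat.factorial_succ, Nat.add_sub_cancel, id, Pi.neg_apply, Pi.pow_apply]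
  push_cast
  field_simp
  ring

theorem differentiable_poissonWeight (n : ℕ) : Differentiable ℝ (poissonWeight n) := by
  unfold poissonWeight; fun_prop

/-- The infinitesimal gateway relation. Writing `w_n` for the weights, it follows from `w_n' =
w_{n-1} - w_n` and `x w_n = (n+1) w_{n+1}`; the cases `n = 0, 1` are apart because weights of
negative index are absent. -/
theorem besselOp_poissonWeight (β : ℝ) (n : ℕ) (x : ℝ) :
    besselOp β (poissonWeight n) x = forward β (fun k => poissonWeight k x) n := by
  have hd (n : ℕ) := (differentiable_poissonWeight n).differentiableAt (x := x)
  rcases n with _ | _ | n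
  · simp only [besselOp, deriv_poissonWeight_zero, deriv.fun_neg, forward, neg_neg,
      mul_poissonWeight]
    push_cast
    ring
  · simp only [besselOp, deriv_poissonWeight_succ]
    rw [deriv_fun_sub (hd _) (hd _)]
    simp only [deriv_poissonWeight_succ, deriv_poissonWeight_zero, forward]
    have h0 := mul_poissonWeight 0 x
    have h1 := mul_poissonWeight 1 x
    push_cast at h0 h1 ⊢
    linear_combination -2 * h0 + h1
  · simp only [besselOp, deriv_poissonWeight_succ]
    rw [deriv_fun_sub (hd _) (hd _)]
    simp only [deriv_poissonWeight_succ, forward]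
    have h0 := mul_poissonWeight n x
    have h1 := mul_poissonWeight (n + 1) x
    have h2 := mul_poissonWeight (n + 2) x
    push_cast at h0 h1 h2 ⊢
    linear_combination h0 - 2 * h1 + h2

theorem besselOp_const_mul (β c : ℝ) (F : ℝ → ℝ) (x : ℝ) :
    besselOp β (fun y => c * F y) x = c * besselOp β F x := by
  have h : deriv (fun y => c * F y) = fun y => c * deriv F y := by
    funext y; exact deriv_const_mul_field c
  simp only [besselOp, h, deriv_const_mul_field]
  ring

theorem besselOp_add (β : ℝ) {F G : ℝ → ℝ} (hF : ContDiff ℝ 2 F) (hG : ContDiff ℝ 2 G) (x : ℝ) :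
    besselOp β (fun y => F y + G y) x = besselOp β F x + besselOp β G x := by
  have h : deriv (fun y => F y + G y) = fun y => deriv F y + deriv G y := by
    funext y
    exact deriv_fun_add (hF.differentiable (by norm_num) y) (hG.differentiable (by norm_num) y)
  simp only [besselOp, h]
  rw [deriv_fun_add (hF.differentiable_deriv_two x) (hG.differentiable_deriv_two x)]
  ring

theorem contDiff_polynomial_mul_exp (p : Polynomial ℝ) :
    ContDiff ℝ 2 fun y => p.eval y * Real.exp (-y) :=
  (Polynomial.contDiff_aeval p 2).mul (by fun_prop)

/-- The core of the Bessel generator is the linear span of the Poisson weights. -/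
theorem eval_monomial_mul_exp (n : ℕ) (c y : ℝ) :
    (Polynomial.monomial n c).eval y * Real.exp (-y) = c * n.factorial * poissonWeight n y := by
  rw [Polynomial.eval_monomial, poissonWeight]
  field_simp

theorem bind_poissonKernel_real_singleton (μ : Measure ℝ≥0) (n : ℕ) :
    (μ.bind poissonKernel).real {n} = ∫ x : ℝ≥0, poissonWeight n x ∂μ := by
  rw [Measure.real, Measure.bind_apply (measurableSet_singleton n) (Kernel.aemeasurable _),
    integral_eq_lintegral_of_nonneg_ae (ae_of_all _ fun x => poissonWeight_nonneg n x.coe_nonneg)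
      (Measurable.aestronglyMeasurable (by fun_prop))]
  congr 1
  exact lintegral_congr fun x => poissonMeasure_singleton_eq x n

theorem integral_geomFun_bind_poissonKernel (μ : Measure ℝ≥0) {l : ℝ} (hl : l ≤ 1) :
    ∫ n, geomFun l n ∂(μ.bind poissonKernel) = ∫ x, expFun l x ∂μ := by
  rw [integral_geomFun _ hl, integral_expFun,
    Measure.lintegral_bind (Kernel.aemeasurable _) (Measurable.aemeasurable (by fun_prop))]
  congr 1
  exact lintegral_congr fun x => lintegral_poissonMeasure_geomFun x hl

/-- Kolmogorov's equation for the squared Bessel process, along a family of laws. -/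
theorem kolmogorov_bessel_of_forward {β : ℝ} {m : ℝ → Measure ℝ≥0}
    [∀ t, IsFiniteMeasure (m t)] {t : ℝ}
    (hf : ∀ n, HasDerivWithinAt (fun s => ∫ x : ℝ≥0, poissonWeight n x ∂(m s))
      (forward β (fun k => ∫ x : ℝ≥0, poissonWeight k x ∂(m t)) n) (Set.Ici 0) t)
    (p : Polynomial ℝ) :
    (∀ s, Integrable (fun x : ℝ≥0 => p.eval (x : ℝ) * Real.exp (-(x : ℝ))) (m s)) ∧
    Integrable (fun x : ℝ≥0 => besselOp β (fun y => p.eval y * Real.exp (-y)) x) (m t) ∧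
    HasDerivWithinAt (fun s => ∫ x : ℝ≥0, p.eval (x : ℝ) * Real.exp (-(x : ℝ)) ∂(m s))
      (∫ x : ℝ≥0, besselOp β (fun y => p.eval y * Real.exp (-y)) x ∂(m t)) (Set.Ici 0) t := by
  induction p using Polynomial.induction_on' with
  | add p q ihp ihq =>
    have h1 (x : ℝ) := besselOp_add β (contDiff_polynomial_mul_exp p)
      (contDiff_polynomial_mul_exp q) x
    simp only [Polynomial.eval_add, add_mul, h1]
    refine ⟨fun s => (ihp.1 s).add (ihq.1 s), ihp.2.1.add ihq.2.1, ?_⟩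
    rw [integral_add ihp.2.1 ihq.2.1]
    exact (ihp.2.2.add ihq.2.2).congr (fun s _ => integral_add (ihp.1 s) (ihq.1 s))
      (integral_add (ihp.1 t) (ihq.1 t))
  | monomial n c =>
    simp only [eval_monomial_mul_exp, besselOp_const_mul, besselOp_poissonWeight]
    refine ⟨fun s => (integrable_poissonWeight _ n).const_mul _, (integrable_forward β
      (fun k => integrable_poissonWeight _ k) n).const_mul _, ?_⟩
    simp only [integral_const_mul]
    rw [integral_forward β (fun k => integrable_poissonWeight _ k) n]
    exact (hf n).const_mul _

theorem forward_of_isGeneratedBy_besselGraph {β : ℝ} {P : ℝ≥0 → Kernel ℝ≥0 ℝ≥0}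
    (hP : IsGeneratedBy P (besselGraph β)) (x : ℝ≥0) (n : ℕ) {t : ℝ} (ht : 0 ≤ t) :
    HasDerivWithinAt (fun s : ℝ => ((P s.toNNReal x).bind poissonKernel).real {n})
      (forward β (fun k => ((P t.toNNReal x).bind poissonKernel).real {k}) n) (Set.Ici 0) t := by
  have := hP.isMarkovSemigroup.isMarkovKernel
  have h := hP.kolmogorov (fun y => (Polynomial.monomial n ((n.factorial : ℝ)⁻¹)).eval (y : ℝ) *
    Real.exp (-(y : ℝ)), fun y => besselOp β (fun z =>
      (Polynomial.monomial n ((n.factorial : ℝ)⁻¹)).eval z * Real.exp (-z)) y)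
    ⟨_, rfl, rfl⟩ x t ht
  have hn : ((n.factorial : ℝ)⁻¹) * n.factorial = 1 := by field_simp
  simp only [eval_monomial_mul_exp, hn, one_mul, besselOp_poissonWeight] at h
  rw [integral_forward β (fun k => integrable_poissonWeight _ k) n] at h
  simpa only [bind_poissonKernel_real_singleton] using h

/-- The Poisson mixture of the Bessel law is a law on the integers that solves the birth-death
forward equation, and its generating function is the Laplace transform of the Bessel law. -/
theorem hasTransform_of_isGeneratedBy_besselGraph {β : ℝ} (hβ : 0 < β)
    {P : ℝ≥0 → Kernel ℝ≥0 ℝ≥0} (hP : IsGeneratedBy P (besselGraph β)) (t : ℝ≥0) :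
    HasTransform expFun β t 1 (P t) := by
  have := hP.isMarkovSemigroup.isMarkovKernel
  intro x l hl
  rcases hl.1.eq_or_lt with rfl | hl0
  · simp [expFun]
  have hm := div_one_add_mem_Icc (NNReal.coe_nonneg t) zero_le_one le_rfl hl
  have h := integral_geomFun_of_forward hβ
    (m := fun s : ℝ => (P s.toNNReal x).bind poissonKernel)
    (fun n t ht => forward_of_isGeneratedBy_besselGraph hP x n ht) (NNReal.coe_nonneg t)
    ⟨hl0, hl.2⟩
  rw [one_mul] at hm
  rw [integral_geomFun_bind_poissonKernel _ hl.2, integral_geomFun_bind_poissonKernel _ hm.2,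
    Real.toNNReal_zero, hP.isMarkovSemigroup.zero, Kernel.id_apply, integral_dirac,
    Real.toNNReal_coe] at h
  rw [isExpFamily_expFun.lintegral_eq hl, one_mul, ← h]

theorem isGeneratedBy_besselKernel {β : ℝ} (hβ : 0 < β) :
    IsGeneratedBy (besselKernel β) (besselGraph β) where
  isMarkovSemigroup :=
    isMarkovSemigroup_of_hasTransform isExpFamily_expFun (hasTransform_besselKernel hβ)
  kolmogorov := by
    rintro ⟨g, g'⟩ ⟨p, hg, hg'⟩ x t ht
    simp only at hg hg'
    subst hg hg'
    have (t : ℝ≥0) := (hasTransform_besselKernel hβ t).isMarkovKernel isExpFamily_expFun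
    refine (kolmogorov_bessel_of_forward (m := fun s : ℝ => besselKernel β s.toNNReal x)
      (fun n => ?_) p).2.2
    simp only [← bind_poissonKernel_real_singleton]
    refine forward_of_integral_geomFun (m := fun s : ℝ => (besselKernel β s.toNNReal x).bind
      poissonKernel) (h := fun l => expFun l x) ?_ (fun s hs l hl => ?_) n ht
    · intro l _
      exact analyticAt_rexp.fun_comp (analyticAt_id.fun_mul analyticAt_const).fun_neg
    · rw [integral_geomFun_bind_poissonKernel _ hl.2,
        (hasTransform_besselKernel hβ _).integral isExpFamily_expFun (NNReal.coe_nonneg _)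
        zero_le_one le_rfl x ⟨hl.1.le, hl.2⟩, Real.coe_toNNReal s hs, one_mul]

theorem isGeneratedBy_besselSemigroup {β : ℝ} (hβ : 0 < β) :
    IsGeneratedBy (besselSemigroup β) (besselGraph β) :=
  Classical.epsilon_spec (p := fun P => IsGeneratedBy P (besselGraph β))
    ⟨_, isGeneratedBy_besselKernel hβ⟩

theorem isGeneratedBy_birthDeathSemigroup {β : ℝ} (hβ : 0 < β) :
    IsGeneratedBy (birthDeathSemigroup β) (birthDeathGraph β) :=
  Classical.epsilon_spec (p := fun P => IsGeneratedBy P (birthDeathGraph β))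
    ⟨_, isGeneratedBy_birthDeathKernel hβ⟩

/-! ### The Laguerre kernels -/

theorem hasTransform_laguerreKernel {β ς t : ℝ} (hβ : 0 < β) (hς : 0 < ς) (ht : 0 ≤ t) :
    HasTransform expFun β (ς * (1 - Real.exp (-t))) (Real.exp (-t)) (laguerreKernel β ς t) := by
  intro x l hl
  have hc := Real.exp_pos (-t)
  have hc1 : Real.exp (-t) ≤ 1 := Real.exp_le_one_iff.2 (by linarith)
  have hτ : 0 ≤ ς * (Real.exp t - 1) := mul_nonneg hς.le (by linarith [Real.one_le_exp ht])
  rw [laguerreKernel, Kernel.lintegral_comp _ _ _ (by fun_prop)]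
  simp only [lintegral_dilation_expFun hc.le]
  rw [hasTransform_of_isGeneratedBy_besselGraph hβ (isGeneratedBy_besselSemigroup hβ) _ _ _
    ⟨mul_nonneg hl.1 hc.le, mul_le_one₀ hl.2 hc.le hc1⟩, Real.coe_toNNReal _ hτ]
  -- The dilation replaces `l` by `l e^{-t}` before the Bessel kernel acts at time `ς(e^t - 1)`.
  have e : ς * (Real.exp t - 1) * (l * Real.exp (-t)) = ς * (1 - Real.exp (-t)) * l := by
    have : Real.exp t * Real.exp (-t) = 1 := by rw [← Real.exp_add]; simp
    linear_combination ς * l * this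
  rw [e, one_mul, mul_comm l]

theorem hasTransform_discreteLaguerreKernel {β θ t : ℝ} (hβ : 0 < β) (hθ : 0 < θ) (ht : 0 ≤ t) :
    HasTransform geomFun β (θ * (1 - Real.exp (-t))) (Real.exp (-t))
      (discreteLaguerreKernel β θ t) := by
  intro x l hl
  have hc := Real.exp_pos (-t)
  have hc1 : Real.exp (-t) ≤ 1 := Real.exp_le_one_iff.2 (by linarith)
  have hτ : 0 ≤ θ * (Real.exp t - 1) := mul_nonneg hθ.le (by linarith [Real.one_le_exp ht])
  rw [discreteLaguerreKernel, Kernel.lintegral_comp _ _ _ (by fun_prop)]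
  simp only [lintegral_thinning_geomFun hc.le hc1 _ hl.2]
  rw [hasTransform_of_isGeneratedBy_birthDeathGraph hβ (isGeneratedBy_birthDeathSemigroup hβ) _ _ _
    ⟨mul_nonneg hl.1 hc.le, mul_le_one₀ hl.2 hc.le hc1⟩, Real.coe_toNNReal _ hτ]
  have e : θ * (Real.exp t - 1) * (l * Real.exp (-t)) = θ * (1 - Real.exp (-t)) * l := by
    have : Real.exp t * Real.exp (-t) = 1 := by rw [← Real.exp_add]; simp
    linear_combination θ * l * this
  rw [e, one_mul, mul_comm l]

/-- The law `ρ` with transform `(1 + θ l)^{-β}` is invariant. -/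
theorem bind_eq_self_of_hasTransform {E : Type} [MeasurableSpace E] {φ : ℝ → E → ℝ}
    (hφ : IsExpFamily φ) {β θ c : ℝ} {κ : Kernel E E} (hθ : 0 < θ) (hc : 0 ≤ c) (hc1 : c ≤ 1)
    (hκ : HasTransform φ β (θ * (1 - c)) c κ) {ρ : Measure E} [IsProbabilityMeasure ρ]
    (hρ : ∀ l ∈ Set.Icc (0 : ℝ) 1,
      ∫⁻ x, ENNReal.ofReal (φ l x) ∂ρ = ENNReal.ofReal ((1 + θ * l) ^ (-β))) :
    ρ.bind κ = ρ := by
  have := hκ.isMarkovKernel hφ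
  have ha : 0 ≤ θ * (1 - c) := mul_nonneg hθ.le (by linarith)
  refine hφ.ext _ _ fun l hl => ?_
  have hl' : l ∈ Set.Icc (0 : ℝ) 1 := ⟨hl.1.le, hl.2⟩
  have hA : 0 < 1 + θ * (1 - c) * l := by have := mul_nonneg ha hl.1.le; linarith
  have hm := div_one_add_mem_Icc ha hc hc1 hl'
  rw [Measure.lintegral_bind (Kernel.aemeasurable _) (hφ.measurable l).ennreal_ofReal.aemeasurable,
    hρ l hl']
  simp only [hκ _ l hl', ENNReal.ofReal_mul (Real.rpow_nonneg hA.le _)]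
  rw [lintegral_const_mul _ (hφ.measurable _).ennreal_ofReal, hρ _ hm,
    ← ENNReal.ofReal_mul (Real.rpow_nonneg hA.le _),
    ← Real.mul_rpow hA.le (by have := hm.1; positivity)]
  -- The remaining identity is `(1 + θ(1-c)l)(1 + θcl/(1 + θ(1-c)l)) = 1 + θl`.
  congr 2
  field_simp
  ring

/-! ### Markov kernels as contractions between `L²` spaces -/

section L2Action

variable {X Y : Type} [MeasurableSpace X] [MeasurableSpace Y] {κ : Kernel X Y}

theorem enorm_integral_sq_le {μ : Measure Y} [IsProbabilityMeasure μ] {f : Y → ℝ}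
    (hf : AEStronglyMeasurable f μ) : ‖∫ y, f y ∂μ‖ₑ ^ (2 : ℝ) ≤ ∫⁻ y, ‖f y‖ₑ ^ (2 : ℝ) ∂μ := by
  have h1 : ‖∫ y, f y ∂μ‖ₑ ≤ eLpNorm f 2 μ :=
    (enorm_integral_le_lintegral_enorm f).trans (eLpNorm_one_eq_lintegral_enorm.symm.le.trans
      (eLpNorm_le_eLpNorm_of_exponent_le (by norm_num) hf))
  refine (ENNReal.rpow_le_rpow h1 (by norm_num)).trans ?_
  rw [eLpNorm_eq_lintegral_rpow_enorm_toReal (by norm_num) (by norm_num), ← ENNReal.rpow_mul]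
  simp

variable {ρ : Measure X} {f : Y → ℝ}

/-- A `ρκ`-null set is `κ(x)`-null for `ρ`-almost every `x`; this is also why the kernel acts on
classes of functions. -/
theorem ae_aestronglyMeasurable_of_bind (hf : AEStronglyMeasurable f (ρ.bind κ)) :
    ∀ᵐ x ∂ρ, AEStronglyMeasurable f (κ x) := by
  filter_upwards [Measure.ae_ae_of_ae_bind (Kernel.aemeasurable κ) hf.ae_eq_mk] with x hx
  exact ⟨_, hf.stronglyMeasurable_mk, hx⟩

theorem lintegral_bind_enorm_sq (hf : AEStronglyMeasurable f (ρ.bind κ)) :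
    ∫⁻ x, ∫⁻ y, ‖f y‖ₑ ^ (2 : ℝ) ∂(κ x) ∂ρ = ∫⁻ y, ‖f y‖ₑ ^ (2 : ℝ) ∂(ρ.bind κ) :=
  (Measure.lintegral_bind (Kernel.aemeasurable κ) (hf.enorm.pow_const _)).symm

theorem aestronglyMeasurable_integral_kernel (hf : AEStronglyMeasurable f (ρ.bind κ)) :
    AEStronglyMeasurable (fun x => ∫ y, f y ∂(κ x)) ρ := by
  refine ⟨_, hf.stronglyMeasurable_mk.integral_kernel (κ := κ), ?_⟩
  filter_upwards [Measure.ae_ae_of_ae_bind (Kernel.aemeasurable κ) hf.ae_eq_mk] with x hx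
  exact integral_congr_ae hx

theorem ae_memLp_of_memLp_bind (hf : MemLp f 2 (ρ.bind κ)) : ∀ᵐ x ∂ρ, MemLp f 2 (κ x) := by
  have hfin : ∫⁻ y, ‖f y‖ₑ ^ (2 : ℝ) ∂(ρ.bind κ) ≠ ∞ := by
    have := lintegral_rpow_enorm_lt_top_of_eLpNorm_lt_top (by norm_num) (by norm_num) hf.2
    simpa using this.ne
  rw [← lintegral_bind_enorm_sq hf.1] at hfin
  have hm : AEMeasurable (fun x => ∫⁻ y, ‖f y‖ₑ ^ (2 : ℝ) ∂(κ x)) ρ := by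
    refine ⟨fun x => ∫⁻ y, ‖hf.1.mk f y‖ₑ ^ (2 : ℝ) ∂(κ x),
      (hf.1.stronglyMeasurable_mk.enorm.pow_const _).lintegral_kernel, ?_⟩
    filter_upwards [Measure.ae_ae_of_ae_bind (Kernel.aemeasurable κ) hf.1.ae_eq_mk] with x hx
    exact lintegral_congr_ae (hx.mono fun y hy => by simp only [hy])
  filter_upwards [ae_lt_top' hm hfin, ae_aestronglyMeasurable_of_bind hf.1] with x hx hx'
  refine ⟨hx', ?_⟩
  rw [eLpNorm_lt_top_iff_lintegral_rpow_enorm_lt_top (by norm_num) (by norm_num)]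
  simpa using hx

variable [IsMarkovKernel κ]

theorem eLpNorm_integral_kernel_le (hf : AEStronglyMeasurable f (ρ.bind κ)) :
    eLpNorm (fun x => ∫ y, f y ∂(κ x)) 2 ρ ≤ eLpNorm f 2 (ρ.bind κ) := by
  rw [eLpNorm_eq_lintegral_rpow_enorm_toReal (by norm_num) (by norm_num),
    eLpNorm_eq_lintegral_rpow_enorm_toReal (by norm_num) (by norm_num)]
  simp only [ENNReal.toReal_ofNat]
  rw [← lintegral_bind_enorm_sq hf]
  refine ENNReal.rpow_le_rpow (lintegral_mono_ae ?_) (by norm_num)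
  filter_upwards [ae_aestronglyMeasurable_of_bind hf] with x hx using enorm_integral_sq_le hx

theorem memLp_integral_kernel (hf : MemLp f 2 (ρ.bind κ)) :
    MemLp (fun x => ∫ y, f y ∂(κ x)) 2 ρ :=
  ⟨aestronglyMeasurable_integral_kernel hf.1, (eLpNorm_integral_kernel_le hf.1).trans_lt hf.2⟩

theorem ae_integrable_of_memLp_bind (hf : MemLp f 2 (ρ.bind κ)) :
    ∀ᵐ x ∂ρ, Integrable f (κ x) :=
  (ae_memLp_of_memLp_bind hf).mono fun _ hx => hx.integrable (by norm_num)

variable (κ ρ) in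
/-- The contraction `L²(ρκ) → L²(ρ)` given by a Markov kernel `κ`. -/
def kernelL2 : Lp ℝ 2 (ρ.bind κ) →L[ℝ] Lp ℝ 2 ρ :=
  LinearMap.mkContinuous
    { toFun := fun f => (memLp_integral_kernel (Lp.memLp f)).toLp _
      map_add' := fun f g => by
        rw [← MemLp.toLp_add, MemLp.toLp_eq_toLp_iff]
        filter_upwards [Measure.ae_ae_of_ae_bind (Kernel.aemeasurable κ) (Lp.coeFn_add f g),
          ae_integrable_of_memLp_bind (Lp.memLp f), ae_integrable_of_memLp_bind (Lp.memLp g)]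
          with x hx hf hg
        rw [integral_congr_ae hx]
        exact integral_add hf hg
      map_smul' := fun c f => by
        rw [RingHom.id_apply, ← MemLp.toLp_const_smul, MemLp.toLp_eq_toLp_iff]
        filter_upwards [Measure.ae_ae_of_ae_bind (Kernel.aemeasurable κ) (Lp.coeFn_smul c f)]
          with x hx
        rw [integral_congr_ae hx]
        exact integral_smul c _ } 1 fun f => by
    change ‖(memLp_integral_kernel (Lp.memLp f)).toLp _‖ ≤ _
    rw [Lp.norm_toLp, one_mul, Lp.norm_def]
    exact ENNReal.toReal_mono (Lp.memLp f).2.ne (eLpNorm_integral_kernel_le (Lp.memLp f).1)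

theorem isL2Action_l2Op {π : Measure Y} (h : ρ.bind κ = π) :
    IsL2Action κ ρ π (l2Op κ ρ π) := by
  refine Classical.epsilon_spec (p := IsL2Action κ ρ π) ?_
  subst h
  refine ⟨kernelL2 κ ρ, fun f hf => ⟨ae_integrable_of_memLp_bind hf, ?_⟩⟩
  refine (MemLp.coeFn_toLp (memLp_integral_kernel (Lp.memLp (hf.toLp f)))).trans ?_
  filter_upwards [Measure.ae_ae_of_ae_bind (Kernel.aemeasurable κ) hf.coeFn_toLp] with x hx
  exact integral_congr_ae hx

end L2Action

/-! ### Totality of exponential families in `L²` -/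

section Vectors

variable {E E' : Type} [MeasurableSpace E] [MeasurableSpace E']

/-- The class in `L²` of a function (zero if it is not square integrable). -/
def toL2 (ρ : Measure E) (f : E → ℝ) : Lp ℝ 2 ρ :=
  open Classical in if h : MemLp f 2 ρ then h.toLp f else 0

theorem toL2_eq {ρ : Measure E} {f : E → ℝ} (h : MemLp f 2 ρ) : toL2 ρ f = h.toLp f :=
  dif_pos h

theorem IsL2Action.apply_toL2 {κ : Kernel E E'} {ρ : Measure E} {π : Measure E'}
    {T : Lp ℝ 2 π →L[ℝ] Lp ℝ 2 ρ} (hT : IsL2Action κ ρ π T) {f : E' → ℝ} {g : E → ℝ}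
    (hf : MemLp f 2 π) (hg : MemLp g 2 ρ) (c : ℝ) (h : ∀ x, ∫ y, f y ∂(κ x) = c * g x) :
    T (toL2 π f) = c • toL2 ρ g := by
  rw [toL2_eq hf, toL2_eq hg, ← MemLp.toLp_const_smul]
  refine Lp.ext ((hT f hf).2.trans (Filter.EventuallyEq.trans ?_ (MemLp.coeFn_toLp _).symm))
  exact ae_of_all _ h

theorem inner_toL2 {ρ : Measure E} {f g : E → ℝ} (hf : MemLp f 2 ρ) (hg : MemLp g 2 ρ) :
    inner ℝ (toL2 ρ f) (toL2 ρ g) = ∫ x, f x * g x ∂ρ := by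
  rw [toL2_eq hf, toL2_eq hg, L2.inner_def]
  refine integral_congr_ae ?_
  filter_upwards [hf.coeFn_toLp, hg.coeFn_toLp] with x h1 h2
  rw [h1, h2]
  simp [mul_comm]

theorem IsExpFamily.memLp {φ : ℝ → E → ℝ} (hφ : IsExpFamily φ) (ρ : Measure E) [IsFiniteMeasure ρ]
    {l : ℝ} (hl : l ∈ Set.Icc (0 : ℝ) 1) : MemLp (φ l) 2 ρ :=
  MemLp.of_bound (hφ.measurable l).aestronglyMeasurable 1 (ae_of_all _ fun x => by
    rw [Real.norm_of_nonneg (hφ.nonneg l hl x)]; exact hφ.le_one l hl x)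

/-- `Λ_σ` produces rates `lσ` that may exceed `1`, outside the range covered by `IsExpFamily.memLp`.
-/
theorem memLp_expFun (ρ : Measure ℝ≥0) [IsFiniteMeasure ρ] {l : ℝ} (hl : 0 ≤ l) :
    MemLp (expFun l) 2 ρ :=
  MemLp.of_bound (measurable_expFun l).aestronglyMeasurable 1 (ae_of_all _ fun x => by
    rw [Real.norm_of_nonneg (expFun_pos l x).le]; exact expFun_le_one hl x)

/-- Exponential families are total in `L²`. -/
theorem IsExpFamily.eq_zero_of_inner_eq_zero {φ : ℝ → E → ℝ} (hφ : IsExpFamily φ) {ρ : Measure E}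
    [IsFiniteMeasure ρ] (f : Lp ℝ 2 ρ)
    (h : ∀ l ∈ Set.Ioc (0 : ℝ) 1, inner ℝ (toL2 ρ (φ l)) f = 0) : f = 0 := by
  have hfm : Measurable f := (Lp.stronglyMeasurable f).measurable
  have hfi : Integrable f ρ := (Lp.memLp f).integrable (by norm_num)
  have hfin := isFiniteMeasure_withDensity_ofReal hfi.2
  have hfin' := isFiniteMeasure_withDensity_ofReal hfi.neg.2
  -- The positive and negative parts of `f`, taken as densities, have equal transforms by
  -- orthogonality and hence coincide.
  have hEq : ρ.withDensity (fun x => ENNReal.ofReal (f x)) =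
      ρ.withDensity (fun x => ENNReal.ofReal ((-⇑f) x)) := by
    refine hφ.ext _ _ fun l hl => ?_
    have hl' : l ∈ Set.Icc (0 : ℝ) 1 := ⟨hl.1.le, hl.2⟩
    have hint : Integrable (fun x => φ l x * f x) ρ := (hφ.memLp ρ hl').integrable_mul (Lp.memLp f)
    have h0 : ∫ x, φ l x * f x ∂ρ = 0 := by
      rw [← h l hl, toL2_eq (hφ.memLp ρ hl'), L2.inner_def]
      refine integral_congr_ae ?_
      filter_upwards [(hφ.memLp ρ hl').coeFn_toLp] with x hx
      rw [hx]
      simp [mul_comm]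
    rw [lintegral_withDensity_eq_lintegral_mul _ (by fun_prop) (hφ.measurable l).ennreal_ofReal,
      lintegral_withDensity_eq_lintegral_mul _ (by fun_prop) (hφ.measurable l).ennreal_ofReal]
    simp only [Pi.mul_apply, Pi.neg_apply, mul_comm (ENNReal.ofReal _) (ENNReal.ofReal (φ l _)),
      ← ENNReal.ofReal_mul (hφ.nonneg l hl' _), mul_neg]
    rw [integral_eq_lintegral_pos_part_sub_lintegral_neg_part hint, sub_eq_zero] at h0
    exact (ENNReal.toReal_eq_toReal_iff' hint.lintegral_lt_top.ne
      hint.neg.lintegral_lt_top.ne).1 h0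
  rw [withDensity_eq_iff (by fun_prop) (by fun_prop) hfi.lintegral_lt_top.ne] at hEq
  refine Lp.ext ?_
  filter_upwards [hEq, Lp.coeFn_zero ℝ 2 ρ] with x hx h0
  rw [h0]
  rcases le_total (f x) 0 with hx0 | hx0
  · rw [ENNReal.ofReal_of_nonpos hx0, Pi.neg_apply, eq_comm, ENNReal.ofReal_eq_zero] at hx
    simp only [Pi.zero_apply]
    linarith
  · rw [Pi.neg_apply, ENNReal.ofReal_of_nonpos (neg_nonpos.2 hx0), ENNReal.ofReal_eq_zero] at hx
    simp only [Pi.zero_apply]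
    linarith

/-- Every vector in the range of the adjoint of `T - S` is orthogonal to the family, hence zero. -/
theorem IsExpFamily.clm_ext {φ : ℝ → E → ℝ} (hφ : IsExpFamily φ) {ρ : Measure E}
    [IsFiniteMeasure ρ] {ρ' : Measure E'} {T S : Lp ℝ 2 ρ →L[ℝ] Lp ℝ 2 ρ'}
    (h : ∀ l ∈ Set.Ioc (0 : ℝ) 1, T (toL2 ρ (φ l)) = S (toL2 ρ (φ l))) : T = S := by
  refine ContinuousLinearMap.ext fun v => sub_eq_zero.1 ?_
  refine ext_inner_right ℝ fun w => ?_
  have hw : ContinuousLinearMap.adjoint (T - S) w = 0 :=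
    hφ.eq_zero_of_inner_eq_zero _ fun l hl => by
      rw [ContinuousLinearMap.adjoint_inner_right, sub_apply, h l hl, sub_self,
        inner_zero_left]
  rw [← sub_apply, ← ContinuousLinearMap.adjoint_inner_right, hw,
    inner_zero_right, inner_zero_left]

end Vectors

/-! ### The operators on exponential and geometric functions -/

theorem HasTransform.apply_toL2 {E : Type} [MeasurableSpace E] {φ : ℝ → E → ℝ}
    (hφ : IsExpFamily φ) {β a c : ℝ} {κ : Kernel E E} (h : HasTransform φ β a c κ) (ha : 0 ≤ a)
    (hc : 0 ≤ c) (hc1 : c ≤ 1) {ρ : Measure E} [IsFiniteMeasure ρ]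
    {T : Lp ℝ 2 ρ →L[ℝ] Lp ℝ 2 ρ} (hT : IsL2Action κ ρ ρ T) {l : ℝ} (hl : l ∈ Set.Icc (0 : ℝ) 1) :
    T (toL2 ρ (φ l)) = (1 + a * l) ^ (-β) • toL2 ρ (φ (c * l / (1 + a * l))) :=
  hT.apply_toL2 (hφ.memLp ρ hl) (hφ.memLp ρ (div_one_add_mem_Icc ha hc hc1 hl)) _
    fun x => h.integral hφ ha hc hc1 x hl

section Operators

variable {β ς σ θ t : ℝ}

theorem integral_gammaLaw_expFun (hβ : 0 < β) (hς : 0 < ς) {l : ℝ} (hl : 0 ≤ l) :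
    ∫ x, expFun l x ∂(gammaLaw β ς) = (1 + ς * l) ^ (-β) := by
  rw [integral_expFun, lintegral_gammaLaw_expFun hβ hς hl, ENNReal.toReal_ofReal (by positivity)]

theorem integral_negBinomialLaw_geomFun (hβ : 0 < β) (hθ : 0 < θ) {l : ℝ}
    (hl : l ∈ Set.Icc (0 : ℝ) 1) :
    ∫ x, geomFun l x ∂(negBinomialLaw β θ) = (1 + θ * l) ^ (-β) := by
  have := hl.1
  rw [integral_geomFun _ hl.2, lintegral_negBinomialLaw_geomFun hβ hθ hl.1 hl.2,
    ENNReal.toReal_ofReal (by positivity)]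

theorem isL2Action_poissonOp (hβ : 0 < β) (hς : 0 < ς) (hσ : 0 < σ) :
    IsL2Action (scaledPoissonKernel σ) (gammaLaw β ς) (negBinomialLaw β (ς * σ))
      (poissonOp β ς σ) :=
  isL2Action_l2Op (gammaLaw_bind_scaledPoissonKernel hβ hς hσ)

theorem isL2Action_laguerreOp (hβ : 0 < β) (hς : 0 < ς) (ht : 0 ≤ t) :
    IsL2Action (laguerreKernel β ς t) (gammaLaw β ς) (gammaLaw β ς) (laguerreOp β ς t) := by
  have hK := hasTransform_laguerreKernel hβ hς ht
  have := hK.isMarkovKernel isExpFamily_expFun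
  have := isProbabilityMeasure_gammaLaw hβ hς
  exact isL2Action_l2Op (bind_eq_self_of_hasTransform isExpFamily_expFun hς (Real.exp_pos _).le
    (Real.exp_le_one_iff.2 (by linarith)) hK fun l hl => lintegral_gammaLaw_expFun hβ hς hl.1)

theorem isL2Action_discreteLaguerreOp (hβ : 0 < β) (hθ : 0 < θ) (ht : 0 ≤ t) :
    IsL2Action (discreteLaguerreKernel β θ t) (negBinomialLaw β θ) (negBinomialLaw β θ)
      (discreteLaguerreOp β θ t) := by
  have hK := hasTransform_discreteLaguerreKernel hβ hθ ht
  have := hK.isMarkovKernel isExpFamily_geomFun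
  have := isProbabilityMeasure_negBinomialLaw hβ hθ
  exact isL2Action_l2Op (bind_eq_self_of_hasTransform isExpFamily_geomFun hθ (Real.exp_pos _).le
    (Real.exp_le_one_iff.2 (by linarith)) hK
    fun l hl => lintegral_negBinomialLaw_geomFun hβ hθ hl.1 hl.2)

theorem laguerreOp_expFun (hβ : 0 < β) (hς : 0 < ς) (ht : 0 ≤ t) {l : ℝ}
    (hl : l ∈ Set.Icc (0 : ℝ) 1) :
    laguerreOp β ς t (toL2 (gammaLaw β ς) (expFun l)) =
      (1 + ς * (1 - Real.exp (-t)) * l) ^ (-β) •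
        toL2 (gammaLaw β ς) (expFun (Real.exp (-t) * l / (1 + ς * (1 - Real.exp (-t)) * l))) := by
  have := isProbabilityMeasure_gammaLaw hβ hς
  have hc1 : Real.exp (-t) ≤ 1 := Real.exp_le_one_iff.2 (by linarith)
  exact (hasTransform_laguerreKernel hβ hς ht).apply_toL2 isExpFamily_expFun
    (mul_nonneg hς.le (by linarith)) (Real.exp_pos _).le hc1 (isL2Action_laguerreOp hβ hς ht) hl

theorem discreteLaguerreOp_geomFun (hβ : 0 < β) (hθ : 0 < θ) (ht : 0 ≤ t) {l : ℝ}
    (hl : l ∈ Set.Icc (0 : ℝ) 1) :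
    discreteLaguerreOp β θ t (toL2 (negBinomialLaw β θ) (geomFun l)) =
      (1 + θ * (1 - Real.exp (-t)) * l) ^ (-β) • toL2 (negBinomialLaw β θ)
        (geomFun (Real.exp (-t) * l / (1 + θ * (1 - Real.exp (-t)) * l))) := by
  have := isProbabilityMeasure_negBinomialLaw hβ hθ
  have hc1 : Real.exp (-t) ≤ 1 := Real.exp_le_one_iff.2 (by linarith)
  exact (hasTransform_discreteLaguerreKernel hβ hθ ht).apply_toL2 isExpFamily_geomFun
    (mul_nonneg hθ.le (by linarith)) (Real.exp_pos _).le hc1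
    (isL2Action_discreteLaguerreOp hβ hθ ht) hl

theorem poissonOp_geomFun (hβ : 0 < β) (hς : 0 < ς) (hσ : 0 < σ) {l : ℝ}
    (hl : l ∈ Set.Icc (0 : ℝ) 1) :
    poissonOp β ς σ (toL2 (negBinomialLaw β (ς * σ)) (geomFun l)) =
      toL2 (gammaLaw β ς) (expFun (l * σ)) := by
  have := isProbabilityMeasure_gammaLaw hβ hς
  have := isProbabilityMeasure_negBinomialLaw hβ (mul_pos hς hσ)
  have h := (isL2Action_poissonOp hβ hς hσ).apply_toL2 (isExpFamily_geomFun.memLp _ hl)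
    (memLp_expFun _ (mul_nonneg hl.1 hσ.le)) 1 fun x => by
      rw [integral_geomFun _ hl.2, lintegral_scaledPoissonKernel_geomFun hσ.le x hl.2, one_mul,
        ENNReal.toReal_ofReal (expFun_pos _ _).le]
  rwa [one_smul] at h

/-- The adjoint of `Λ_σ` maps the exponential function of rate `m` to a multiple of the geometric
function of ratio `1 - ς m / (1 + ς σ + ς m)`. -/
theorem poissonAdjoint_expFun (hβ : 0 < β) (hς : 0 < ς) (hσ : 0 < σ) {m : ℝ} (hm : 0 ≤ m) :
    poissonAdjoint β ς σ (toL2 (gammaLaw β ς) (expFun m)) =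
      (1 + ς * m / (1 + ς * σ)) ^ (-β) • toL2 (negBinomialLaw β (ς * σ))
        (geomFun (ς * m / (1 + ς * σ + ς * m))) := by
  have := isProbabilityMeasure_gammaLaw hβ hς
  have := isProbabilityMeasure_negBinomialLaw hβ (mul_pos hς hσ)
  have hmem : ς * m / (1 + ς * σ + ς * m) ∈ Set.Icc (0 : ℝ) 1 := by
    refine ⟨by positivity, ?_⟩
    rw [div_le_one (by positivity)]
    have := mul_pos hς hσ
    linarith
  refine sub_eq_zero.1 (isExpFamily_geomFun.eq_zero_of_inner_eq_zero _ fun l hl => ?_)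
  have hl' : l ∈ Set.Icc (0 : ℝ) 1 := ⟨hl.1.le, hl.2⟩
  have hl0 := hl.1
  rw [inner_sub_right, sub_eq_zero, inner_smul_right, poissonAdjoint,
    ContinuousLinearMap.adjoint_inner_right, poissonOp_geomFun hβ hς hσ hl',
    inner_toL2 (memLp_expFun _ (by positivity)) (memLp_expFun _ hm),
    inner_toL2 (isExpFamily_geomFun.memLp _ hl') (isExpFamily_geomFun.memLp _ hmem)]
  set k := ς * m / (1 + ς * σ + ς * m) with hk
  have he (x : ℝ≥0) : expFun (l * σ) x * expFun m x = expFun (l * σ + m) x := by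
    rw [expFun, expFun, expFun, ← Real.exp_add]
    congr 1
    ring
  have hg (n : ℕ) : geomFun l n * geomFun k n = geomFun (1 - (1 - l) * (1 - k)) n := by
    rw [geomFun, geomFun, geomFun, ← mul_pow, sub_sub_cancel]
  have hmem' : 1 - (1 - l) * (1 - k) ∈ Set.Icc (0 : ℝ) 1 := by
    have h1 : 0 ≤ (1 - l) * (1 - k) := mul_nonneg (by linarith [hl.2]) (by linarith [hmem.2])
    have h2 : (1 - l) * (1 - k) ≤ 1 :=
      mul_le_one₀ (by linarith) (by linarith [hmem.2]) (by linarith [hmem.1])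
    constructor <;> linarith
  simp only [he, hg]
  rw [integral_gammaLaw_expFun hβ hς (by positivity),
    integral_negBinomialLaw_geomFun hβ (mul_pos hς hσ) hmem', ← Real.mul_rpow (by positivity)
      (by have := hmem'.1; positivity)]
  -- The parameter `k` is the one for which `1 + ς(lσ+m)` equals `(1 + ςm/(1+ςσ))(1 +
  -- ςσ(1-(1-l)(1-k)))` for every `l`.
  congr 1
  rw [hk]
  field_simp
  ring

end Operators

/-- The dual gateway relation. -/
theorem discreteLaguerreOp_comp_poissonAdjoint {β ς σ t : ℝ} (hβ : 0 < β) (hς : 0 < ς)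
    (hσ : 0 < σ) (ht : 0 ≤ t) :
    discreteLaguerreOp β (ς * σ) t ∘L poissonAdjoint β ς σ =
      poissonAdjoint β ς σ ∘L laguerreOp β ς t := by
  have := isProbabilityMeasure_gammaLaw hβ hς
  refine isExpFamily_expFun.clm_ext fun m hm => ?_
  have hm' : m ∈ Set.Icc (0 : ℝ) 1 := ⟨hm.1.le, hm.2⟩
  have hm0 := hm.1
  have hc := Real.exp_pos (-t)
  have hc1 : Real.exp (-t) ≤ 1 := Real.exp_le_one_iff.2 (by linarith)
  rw [ContinuousLinearMap.comp_apply, ContinuousLinearMap.comp_apply,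
    poissonAdjoint_expFun hβ hς hσ hm0.le, map_smul, laguerreOp_expFun hβ hς ht hm', map_smul]
  set c := Real.exp (-t) with hcdef
  have hd : 0 ≤ 1 - c := by linarith
  have hA : 0 < 1 + ς * (1 - c) * m := by positivity
  have hB : 0 < 1 + ς * σ + ς * m := by positivity
  have hmem : ς * m / (1 + ς * σ + ς * m) ∈ Set.Icc (0 : ℝ) 1 := by
    refine ⟨by positivity, ?_⟩
    rw [div_le_one hB]
    have := mul_pos hς hσ
    linarith
  rw [discreteLaguerreOp_geomFun hβ (mul_pos hς hσ) ht hmem, ← hcdef,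
    poissonAdjoint_expFun hβ hς hσ (by positivity), smul_smul, smul_smul,
    ← Real.mul_rpow (by positivity) (by positivity), ← Real.mul_rpow (by positivity) (by positivity)]
  -- The common numerator to which the denominators on both sides reduce.
  have hC : 0 < 1 + ς * σ + ς * m + ς * σ * (1 - c) * (ς * m) := by positivity
  congr 2
  · field_simp
    ring
  · congr 1
    have h1 : 1 + ς * σ * (1 - c) * (ς * m / (1 + ς * σ + ς * m)) =
        (1 + ς * σ + ς * m + ς * σ * (1 - c) * (ς * m)) / (1 + ς * σ + ς * m) := by
      field_simp
    have h2 : 1 + ς * σ + ς * (c * m / (1 + ς * (1 - c) * m)) =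
        (1 + ς * σ + ς * m + ς * σ * (1 - c) * (ς * m)) / (1 + ς * (1 - c) * m) := by
      field_simp
      ring
    rw [h1, h2]
    field_simp

theorem exp_neg_log_one_add_one_div {θ : ℝ} (hθ : 0 < θ) :
    Real.exp (-Real.log (1 + 1 / θ)) = θ / (1 + θ) := by
  rw [Real.exp_neg, Real.exp_log (by positivity)]
  field_simp
  ring

/-- The time `s` is fixed by `e^{-s} = ςσ/(1+ςσ)`: then `ς(1-e^{-s}) = ς/(1+ςσ)`, the coefficient in
the factor of the adjoint, and the rates agree as well. The same `s` serves the reversed product,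
where `m = lσ`. -/
theorem poissonOp_comp_poissonAdjoint {β ς σ : ℝ} (hβ : 0 < β) (hς : 0 < ς) (hσ : 0 < σ) :
    poissonOp β ς σ ∘L poissonAdjoint β ς σ = laguerreOp β ς (Real.log (1 + 1 / (ς * σ))) := by
  have := isProbabilityMeasure_gammaLaw hβ hς
  refine isExpFamily_expFun.clm_ext fun m hm => ?_
  have hm' : m ∈ Set.Icc (0 : ℝ) 1 := ⟨hm.1.le, hm.2⟩
  have hm0 := hm.1
  have hθ := mul_pos hς hσ
  have hs : 0 ≤ Real.log (1 + 1 / (ς * σ)) := Real.log_nonneg (by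
    have : 0 < 1 / (ς * σ) := by positivity
    linarith)
  have hmem : ς * m / (1 + ς * σ + ς * m) ∈ Set.Icc (0 : ℝ) 1 := by
    refine ⟨by positivity, ?_⟩
    rw [div_le_one (by positivity)]
    linarith
  rw [ContinuousLinearMap.comp_apply, poissonAdjoint_expFun hβ hς hσ hm0.le, map_smul,
    poissonOp_geomFun hβ hς hσ hmem, laguerreOp_expFun hβ hς hs hm', exp_neg_log_one_add_one_div hθ]
  have h1 : 1 + ς * (1 - ς * σ / (1 + ς * σ)) * m = 1 + ς * m / (1 + ς * σ) := by
    field_simp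
    ring
  rw [h1]
  congr 3
  field_simp

theorem poissonAdjoint_comp_poissonOp {β ς σ : ℝ} (hβ : 0 < β) (hς : 0 < ς) (hσ : 0 < σ) :
    poissonAdjoint β ς σ ∘L poissonOp β ς σ =
      discreteLaguerreOp β (ς * σ) (Real.log (1 + 1 / (ς * σ))) := by
  have hθ := mul_pos hς hσ
  have := isProbabilityMeasure_negBinomialLaw hβ hθ
  refine isExpFamily_geomFun.clm_ext fun l hl => ?_
  have hl' : l ∈ Set.Icc (0 : ℝ) 1 := ⟨hl.1.le, hl.2⟩
  have hl0 := hl.1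
  have hs : 0 ≤ Real.log (1 + 1 / (ς * σ)) := Real.log_nonneg (by
    have : 0 < 1 / (ς * σ) := by positivity
    linarith)
  rw [ContinuousLinearMap.comp_apply, poissonOp_geomFun hβ hς hσ hl',
    poissonAdjoint_expFun hβ hς hσ (by positivity), discreteLaguerreOp_geomFun hβ hθ hs hl',
    exp_neg_log_one_add_one_div hθ]
  have h1 : 1 + ς * σ * (1 - ς * σ / (1 + ς * σ)) * l = 1 + ς * (l * σ) / (1 + ς * σ) := by
    field_simp
    ring
  rw [h1]
  congr 3
  field_simp

end

end Gateway

theorem proposition25 (β ς σ : ℝ) (hβ : 0 < β) (hς : 0 < ς) (hσ : 0 < σ) :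
    -- the semigroups and the `L²` operators are well defined
    (Gateway.IsGeneratedBy (Gateway.besselSemigroup β) (Gateway.besselGraph β) ∧
      Gateway.IsGeneratedBy (Gateway.birthDeathSemigroup β) (Gateway.birthDeathGraph β) ∧
      Gateway.IsL2Action (Gateway.scaledPoissonKernel σ)
        (Gateway.gammaLaw β ς) (Gateway.negBinomialLaw β (ς * σ)) (Gateway.poissonOp β ς σ) ∧
      ∀ t : ℝ, 0 ≤ t →
        Gateway.IsL2Action (Gateway.laguerreKernel β ς t)
          (Gateway.gammaLaw β ς) (Gateway.gammaLaw β ς) (Gateway.laguerreOp β ς t) ∧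
        Gateway.IsL2Action (Gateway.discreteLaguerreKernel β (ς * σ) t)
          (Gateway.negBinomialLaw β (ς * σ)) (Gateway.negBinomialLaw β (ς * σ))
          (Gateway.discreteLaguerreOp β (ς * σ) t)) ∧
    -- the dual gateway relation `𝕂_t Λ̂ = Λ̂ K_t`
    (∀ t : ℝ, 0 ≤ t →
      Gateway.discreteLaguerreOp β (ς * σ) t ∘L Gateway.poissonAdjoint β ς σ =
        Gateway.poissonAdjoint β ς σ ∘L Gateway.laguerreOp β ς t) ∧
    -- the products `Λ_σ Λ̂ = K_s` and `Λ̂ Λ_σ = 𝕂_s`, with `s = ln (1 + 1 / (ς σ))`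
    Gateway.poissonOp β ς σ ∘L Gateway.poissonAdjoint β ς σ =
      Gateway.laguerreOp β ς (Real.log (1 + 1 / (ς * σ))) ∧
    Gateway.poissonAdjoint β ς σ ∘L Gateway.poissonOp β ς σ =
      Gateway.discreteLaguerreOp β (ς * σ) (Real.log (1 + 1 / (ς * σ))) :=
  ⟨⟨Gateway.isGeneratedBy_besselSemigroup hβ, Gateway.isGeneratedBy_birthDeathSemigroup hβ,
    Gateway.isL2Action_poissonOp hβ hς hσ, fun _ ht =>
      ⟨Gateway.isL2Action_laguerreOp hβ hς ht,
        Gateway.isL2Action_discreteLaguerreOp hβ (mul_pos hς hσ) ht⟩⟩,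
    fun _ ht => Gateway.discreteLaguerreOp_comp_poissonAdjoint hβ hς hσ ht,
    Gateway.poissonOp_comp_poissonAdjoint hβ hς hσ,
    Gateway.poissonAdjoint_comp_poissonOp hβ hς hσ⟩
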